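/- Let $k\ge 4$ be an even integer and let $f(\tau)=\sum_{n\ge 0}a_f(n)q^n$, $q=e^{2\pi i\tau}$, be a modular form of weight $k$ and level one with real Fourier coefficients, such that the first non-zero coefficient $a_f(m)$ with $m\ge 1$ is positive (for instance a normalised Hecke eigenform, where $m=1$ and $a_f(1)=1$). Let $L_f(s)$ be the analytic continuation of $\sum_{n\ge 1}a_f(n)n^{-s}$. Put $\vartheta_k(t)=\arg\Gamma(\tfrac k2+it)-t\log 2\pi$, where $\arg\Gamma(\tfrac k2+it)$ is continuous in $t$ and vanishes at $t=0$. For real $t$ let $\arg L_f(\sigma+it)$ be defined by continuous variation along the ray $\sigma>\tfrac k2$, starting from $\sigma=+\infty$, where $\arg L_f(\sigma+it)\to -t\log m$ (which is $0$ if $m=1$); it is defined only if $L_f$ has no zero on this ray. Write $$S(t)=\lim_{\delta\to0^+}\arg L_f(\tfrac k2+\delta+it)$$ and consider, for integers $n$, the equation $$(\mathrm E_n)\qquad \vartheta_k(t)+S(t)=\Big(n-\frac{1+(-1)^{k/2}}{4}\Big)\pi .$$ (1) Let $t$ be a real number for which the limit $S(t)$ exists. If $\tfrac k2+it$ is a simple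 zero of $L_f$, then $t$ satisfies $(\mathrm E_n)$ for some integer $n$. Conversely, if $t$ satisfies $(\mathrm E_n)$ for some integer $n$, then $L_f(\tfrac k2+it)=0$. (2) Suppose that the limit $S(t)$ exists for every real $t$. Then $L_f$ has infinitely many zeros $\tfrac k2+it$ with $t>0$. Moreover, $(\mathrm E_n)$ has exactly one real solution for every $n=1,2,\dots$ if and only if all zeros of $L_f$ on the line $\Re s=\tfrac k2$ are simple. If these equivalent conditions hold, then: (a) the zeros of $L_f$ on this line with positive imaginary part are $\tfrac k2+it_n$, $n=1,2,\dots$, with $0<t_1<t_2<\cdots$, and for every $n\ge 1$ the number $t_n$ is the unique real solution of $(\mathrm E_n)$; (b) for every $T>0$ with $L_f(\tfrac k2+iT)\ne0$, the number $N_0(T)$ of $t$ with $0<t<T$ that solve $(\mathrm E_n)$ for some $n\ge1$ is finite and $$N_0(T)=\frac1\pi\vartheta_k(T)+\frac1\pi\arg L_f(\tfrac k2+iT)-\frac{1-(-1)^{k/2}}{4},$$ where $\arg L_f(\tfrac k2+iT)=S(T)$. (3) In particular (1) and (2) hold for $\Delta=\eta^{24}=\sum_{n\ge1}\tau(n)q^n$,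 of weight $k=12$, where $(\mathrm E_n)$ reads $\vartheta_{12}(t)+\lim_{\delta\to0^+}\arg L_\Delta(6+\delta+it)=(n-\tfrac12)\pi$ and $N_0(T)=\frac1\pi\vartheta_{12}(T)+\frac1\pi\arg L_\Delta(6+iT)$. -/

import Mathlib

open Filter Topology MatrixGroups

noncomputable section

namespace ModularZeros

/-- The Fourier coefficient `a_f(n)` in `f(τ) = ∑ a_f(n) q^n`, `q = e^{2πiτ}`. -/
def qCoeff {k : ℤ} (f : ModularForm 𝒮ℒ k) (n : ℕ) : ℂ :=
  (UpperHalfPlane.qExpansion 1 f).coeff n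

/-- The least `n ≥ 1` with `a_f(n) ≠ 0` (it is `1` for a normalised eigenform). -/
def leadIndex {k : ℤ} (f : ModularForm 𝒮ℒ k) : ℕ :=
  sInf {n : ℕ | 1 ≤ n ∧ qCoeff f n ≠ 0}

/-- The `L`-function of `f`: the analytic continuation of `∑_{n ≥ 1} a_f(n) n^{-s}`,
so that `(2π)^{-s} Γ(s) L_f(s) = Λ_f(s)`. -/
def LFun {k : ℤ} (hk : 4 ≤ k) (f : ModularForm 𝒮ℒ k) (s : ℂ) : ℂ :=
  ModularForm.L (lt_of_lt_of_le four_pos hk) f s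

/-- The point `k/2 + i t` of the critical line. -/
def critPt (k : ℤ) (t : ℝ) : ℂ := (k : ℂ) / 2 + t * Complex.I

/-- `k/2 + i t` is a simple zero of `L_f`. -/
def IsSimpleZero {k : ℤ} (hk : 4 ≤ k) (f : ModularForm 𝒮ℒ k) (t : ℝ) : Prop :=
  LFun hk f (critPt k t) = 0 ∧ deriv (LFun hk f) (critPt k t) ≠ 0

/-- The continuous determination of `t ↦ arg Γ(a + i t)` that vanishes at `t = 0`
(for `a > 0`), as the integral of its derivative `Re (Γ'/Γ)(a + i t)`. -/
def argGamma (a t : ℝ) : ℝ :=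
  ∫ u in (0 : ℝ)..t, (Complex.digamma ((a : ℂ) + u * Complex.I)).re

/-- `ϑ_k(t) = arg Γ(k/2 + i t) - t log 2π`. -/
def theta (k : ℤ) (t : ℝ) : ℝ :=
  argGamma ((k : ℝ) / 2) t - t * Real.log (2 * Real.pi)

/-- `lim_{δ → 0+} arg L_f(k/2 + δ + i t)` exists and equals `ℓ`. Here `arg L_f` is defined by
continuous variation along the ray `{σ + i t : σ > k/2}`, on which `L_f` must have no zero,
starting from `σ = +∞`, where `L_f(s) ~ a_f(m) m^{-s}` with `m = leadIndex f`, `a_f(m) > 0`: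
there `arg L_f(σ + i t) → - t log m`, which is `0` if `m = 1`. -/
def HasArgLimit {k : ℤ} (hk : 4 ≤ k) (f : ModularForm 𝒮ℒ k) (t ℓ : ℝ) : Prop :=
  ∃ φ : ℝ → ℝ,
    ContinuousOn φ (Set.Ioi ((k : ℝ) / 2)) ∧
    (∀ σ : ℝ, (k : ℝ) / 2 < σ →
      LFun hk f ((σ : ℂ) + t * Complex.I) ≠ 0 ∧
      LFun hk f ((σ : ℂ) + t * Complex.I) =
        (‖LFun hk f ((σ : ℂ) + t * Complex.I)‖ : ℂ) * Complex.exp ((φ σ : ℂ) * Complex.I)) ∧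
    Tendsto φ atTop (𝓝 (-(t * Real.log (leadIndex f)))) ∧
    Tendsto φ (𝓝[>] ((k : ℝ) / 2)) (𝓝 ℓ)

/-- The modular discriminant `Δ = η^24 = ∑ τ(n) q^n` as a modular form of weight 12. -/
def Delta : ModularForm 𝒮ℒ 12 := CuspForm.toModularFormₗ CuspForm.discriminant

end ModularZeros

end

open ModularZeros

namespace ModularZeros

/-! Write Λ(s) = (2π)^{-s} Γ(s) L_f(s) and ε = (-1)^{k/2}. The functional equation Λ(k - s) = εΛ(s)
and the reality of the coefficients give conj Λ = εΛ on Re s = k/2, so Λ is real or purely imaginary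
there. The Gamma factor at k/2 + it is a positive number times e^{iϑ_k(t)}. Hence at a non-zero of
L_f the phase ϑ_k + S lies in π(ℤ + γ) with γ = (1 - ε)/4. At a simple zero S(t) is the argument of
L_f', because the zero is approached along a horizontal ray; differentiating conj Λ = εΛ along the
vertical line brings in a factor i, which moves the phase to π(ℤ + γ - 1/2). These two cosets are
disjoint, and (E_n) asks for the second. This is (1): `phase_of_ne_zero`, `phase_of_simple_zero`.

If S exists everywhere, L_f has no zeros right of the line, and there is no pole at s = k because
the sign change of s - k would break the continuity of the argument (`HasArgLimit.qCoeff_zero`). So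
L_f has a continuous argument on Re s > k/2 whose boundary values are S. Near a zero of order m that
argument is m arg(s - s₀) plus a continuous function; its boundary value gains mπ/2 on passing from
just below the zero to it and again on passing just above (`exists_local_jump`). Therefore F = (ϑ_k
+ S)/π is constant between zeros, jumps by m in total, takes the midpoint of the jump at the zero,
and F(0) = 0 (`isStepFunction_theta_add`). The rest of (2) is the combinatorics of such step
functions: (E_n) puts F at a midpoint between consecutive plateaux of ℤ + γ. A simple jump meets
exactly one such level; a jump of height at least 2 crosses several, but F can attain only one of
them.

Every level is reached because there are infinitely many zeros (`infinite_zeros`). Otherwise Λ,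
entire, bounded by (N + k)! up to a constant on |s| ≤ N and without zeros off the line, would be a
finite product of linear factors times e^{A + Bs}; but Λ(n + 1) grows like n! up to a geometric
factor. -/

/-- `F` is locally constant away from a discrete set of points `t` with `ord t ≠ 0`, jumps by
`ord t / 2` on either side of `t`, and its plateaux lie in `ℤ + γ`, where `γ ∈ {0, 1/2}`. -/
structure IsStepFunction (F : ℝ → ℝ) (ord : ℝ → ℕ) (γ : ℝ) : Prop where
  gamma_eq : γ = 0 ∨ γ = 1 / 2
  right : ∀ t, ∃ r > 0, ∀ u, t < u → u < t + r → F u = F t + ord t / 2 ∧ ord u = 0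
  left : ∀ t, ∃ r > 0, ∀ u, t - r < u → u < t → F u = F t - ord t / 2 ∧ ord u = 0
  plateau : ∀ t, ord t = 0 → ∃ n : ℤ, F t = n + γ
  zero : F 0 = 0

/-! ### Levels and counting for half-jump step functions. -/

namespace IsStepFunction

variable {F : ℝ → ℝ} {ord : ℝ → ℕ} {γ : ℝ}

/-- A first drop below F a cannot occur: at the infimum of the points where F < F a, the left
condition keeps the value at least F a and the right condition prevents a fall immediately
afterwards. -/
theorem monotone (h : IsStepFunction F ord γ) : Monotone F := by
  intro a b hab
  have hcl : ∀ x ∈ Set.Icc a b, F a ≤ F x := by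
    by_contra! hne
    obtain ⟨x, hx, hlt⟩ := hne
    set A := {y | y ∈ Set.Icc a b ∧ F y < F a} with hA
    have hAne : A.Nonempty := ⟨x, hx, hlt⟩
    have hAb : BddBelow A := ⟨a, fun y hy => hy.1.1⟩
    set s := sInf A
    have has : a ≤ s := le_csInf hAne fun y hy => hy.1.1
    have hsb : s ≤ b := (csInf_le hAb ⟨hx, hlt⟩).trans hx.2
    have hbelow : ∀ y, a ≤ y → y < s → F a ≤ F y := by
      intro y hay hys
      by_contra! hc
      exact absurd (csInf_le hAb ⟨⟨hay, hys.le.trans hsb⟩, hc⟩) (not_le.2 hys)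
    obtain ⟨r, hr, hR⟩ := h.right s
    obtain ⟨r', hr', hL⟩ := h.left s
    have hs : F a ≤ F s := by
      rcases has.eq_or_lt with e | hlt'
      · rw [← e]
      · have h1 := hbelow (max a (s - r' / 2)) (le_max_left _ _) (max_lt hlt' (by linarith))
        have h2 := (hL (max a (s - r' / 2)) (lt_max_of_lt_right (by linarith))
          (max_lt hlt' (by linarith))).1
        have : (0 : ℝ) ≤ ord s / 2 := by positivity
        linarith
    obtain ⟨y, hyA, hy⟩ := exists_lt_of_csInf_lt hAne (show sInf A < s + r by
      change s < s + r; linarith)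
    have hsy : s ≤ y := csInf_le hAb hyA
    rcases hsy.eq_or_lt with e | hlt'
    · exact absurd hyA.2 (not_lt.2 (e ▸ hs))
    · have h2 := (hR y hlt' hy).1
      have : (0 : ℝ) ≤ ord s / 2 := by positivity
      linarith [hyA.2]
  exact hcl b ⟨hab, le_rfl⟩

theorem add_le (h : IsStepFunction F ord γ) {t u : ℝ} (htu : t < u) :
    F t + ord t / 2 ≤ F u := by
  obtain ⟨r, hr, hR⟩ := h.right t
  have hlt : t < min u (t + r / 2) := lt_min htu (by linarith)
  rw [← (hR (min u (t + r / 2)) hlt (min_lt_of_right_lt (by linarith))).1]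
  exact h.monotone (min_le_left _ _)

theorem le_sub (h : IsStepFunction F ord γ) {t u : ℝ} (hut : u < t) :
    F u ≤ F t - ord t / 2 := by
  obtain ⟨r, hr, hL⟩ := h.left t
  have hlt : max u (t - r / 2) < t := max_lt hut (by linarith)
  rw [← (hL (max u (t - r / 2)) (lt_max_of_lt_right (by linarith)) hlt).1]
  exact h.monotone (le_max_left _ _)

theorem add_mem (h : IsStepFunction F ord γ) (t : ℝ) : ∃ n : ℤ, F t + ord t / 2 = n + γ := by
  obtain ⟨r, hr, hR⟩ := h.right t
  obtain ⟨h1, h2⟩ := hR (t + r / 2) (by linarith) (by linarith)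
  exact h1 ▸ h.plateau _ h2

/-- The levels n - (1/2 - γ) lie exactly halfway between the possible plateau values. -/
theorem ord_ne_zero (h : IsStepFunction F ord γ) {t : ℝ} {n : ℤ}
    (ht : F t = n - (1 / 2 - γ)) : ord t ≠ 0 := by
  intro h0
  obtain ⟨j, hj⟩ := h.plateau t h0
  have h1 : ((2 * j + 1 : ℤ) : ℝ) = ((2 * n : ℤ) : ℝ) := by
    push_cast; linarith
  have h2 : 2 * j + 1 = 2 * n := by exact_mod_cast h1
  omega

/-- A point on such a level has positive order, so F is larger by at least 1/2 at every later point.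
-/
theorem eq_of_eq (h : IsStepFunction F ord γ) {t u : ℝ} {n : ℤ}
    (ht : F t = n - (1 / 2 - γ)) (hu : F u = n - (1 / 2 - γ)) : t = u := by
  have key : ∀ {t u : ℝ}, F t = n - (1 / 2 - γ) → F u = n - (1 / 2 - γ) → ¬ t < u := by
    intro t u ht hu hlt
    have h1 := h.add_le hlt
    have h2 : (1 : ℝ) ≤ ord t := by exact_mod_cast Nat.one_le_iff_ne_zero.2 (h.ord_ne_zero ht)
    linarith
  exact le_antisymm (not_lt.1 (key hu ht)) (not_lt.1 (key ht hu))

theorem nonpos (h : IsStepFunction F ord γ) {t : ℝ} (ht : t ≤ 0) : F t ≤ 0 :=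
  h.zero ▸ h.monotone ht

theorem nonneg (h : IsStepFunction F ord γ) {t : ℝ} (ht : 0 ≤ t) : 0 ≤ F t :=
  h.zero ▸ h.monotone ht

theorem pos_of_eq (h : IsStepFunction F ord γ) {t : ℝ} {n : ℕ} (hn : 1 ≤ n)
    (ht : F t = n - (1 / 2 - γ)) : 0 < t := by
  by_contra! hc
  have h1 := h.nonpos hc
  have h2 : (1 : ℝ) ≤ n := by exact_mod_cast hn
  rcases h.gamma_eq with e | e <;> rw [e] at ht <;> linarith

/-- Each jump point raises all later values of F by at least 1/2, so ⌊2F⌋ is injective on jump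
points; a bound on F would leave it finitely many values. -/
theorem exists_gt (h : IsStepFunction F ord γ) (hinf : {t | 0 < t ∧ ord t ≠ 0}.Infinite)
    (M : ℝ) : ∃ t, M ≤ F t := by
  by_contra! hc
  refine hinf (Set.Finite.of_injOn (f := fun t => ⌊2 * F t⌋) (t := Set.Icc 0 ⌈2 * M⌉) ?_ ?_
    (Set.finite_Icc _ _))
  · rintro t ⟨ht, -⟩
    refine ⟨Int.floor_nonneg.2 (by linarith [h.nonneg ht.le]), ?_⟩
    exact_mod_cast (Int.floor_le (2 * F t)).trans
      ((by linarith [hc t] : 2 * F t ≤ 2 * M).trans (Int.le_ceil _))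
  · have key : ∀ t, ord t ≠ 0 → ∀ u, t < u → ⌊2 * F t⌋ < ⌊2 * F u⌋ := by
      intro t ht u htu
      have h1 := h.add_le htu
      have h2 : (1 : ℝ) ≤ ord t := by exact_mod_cast Nat.one_le_iff_ne_zero.2 ht
      have h3 : ⌊2 * F t⌋ + 1 ≤ ⌊2 * F u⌋ := by
        rw [← Int.floor_add_one]; exact Int.floor_le_floor (by linarith)
      omega
    rintro t ⟨-, ht⟩ u ⟨-, hu⟩ he
    rcases lt_trichotomy t u with hlt | he' | hlt
    · exact absurd he (key t ht u hlt).ne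
    · exact he'
    · exact absurd he.symm (key u hu t hlt).ne

/-- At the infimum s of {v ≤ F} the level v lies in (F s - ord s / 2, F s + ord s / 2]. Hence s is a
jump, of order one by assumption, and since its upper end lies in ℤ + γ its midpoint can only be v.
-/
theorem exists_eq (h : IsStepFunction F ord γ) (hinf : {t | 0 < t ∧ ord t ≠ 0}.Infinite)
    (hord : ∀ t, ord t ≤ 1) {n : ℕ} (hn : 1 ≤ n) : ∃ t, F t = n - (1 / 2 - γ) := by
  set v : ℝ := n - (1 / 2 - γ) with hv
  have hv0 : 0 < v := by
    have h2 : (1 : ℝ) ≤ n := by exact_mod_cast hn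
    rcases h.gamma_eq with e | e <;> rw [hv, e] <;> linarith
  set A := {t | v ≤ F t}
  have hAne : A.Nonempty := h.exists_gt hinf v
  have hAb : BddBelow A := ⟨0, fun t ht => by
    by_contra! hc
    exact absurd (h.nonpos hc.le) (not_le.2 (hv0.trans_le ht))⟩
  set s := sInf A
  obtain ⟨r, hr, hR⟩ := h.right s
  obtain ⟨r', hr', hL⟩ := h.left s
  have h1 : F s - ord s / 2 < v := by
    rw [← (hL (s - r' / 2) (by linarith) (by linarith)).1]
    by_contra! hc
    exact absurd (csInf_le hAb (show s - r' / 2 ∈ A from hc)) (not_le.2 (by change _ < s; linarith))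
  have h2 : v ≤ F s + ord s / 2 := by
    obtain ⟨y, hyA, hy⟩ := exists_lt_of_csInf_lt hAne (show sInf A < s + r by
      change s < s + r; linarith)
    rcases (csInf_le hAb hyA).eq_or_lt with e | hlt
    · have h3 : v ≤ F s := by
        have : s = y := e
        rw [this]; exact hyA
      have : (0 : ℝ) ≤ ord s / 2 := by positivity
      linarith
    · rw [← (hR y hlt hy).1]; exact hyA
  have ho : ord s = 1 := by
    refine le_antisymm (hord s) (Nat.one_le_iff_ne_zero.2 fun h0 => ?_)
    rw [h0] at h1 h2
    simp only [CharP.cast_eq_zero, zero_div, sub_zero, add_zero] at h1 h2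
    linarith
  obtain ⟨j, hj⟩ := h.add_mem s
  rw [ho] at h1 h2 hj
  simp only [Nat.cast_one] at h1 h2 hj
  have h3 : (n : ℝ) < j + 1 := by linarith
  have h4 : (j : ℝ) < n + 1 := by linarith
  have h5 : (n : ℤ) < j + 1 := by exact_mod_cast h3
  have h6 : j < (n : ℤ) + 1 := by exact_mod_cast h4
  have h7 : j = (n : ℤ) := by omega
  refine ⟨s, ?_⟩
  rw [h7] at hj
  push_cast at hj
  linarith

theorem eq_of_ord_eq_one (h : IsStepFunction F ord γ) {t : ℝ} (ht : 0 < t) (ho : ord t = 1) :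
    ∃ n : ℕ, 1 ≤ n ∧ F t = n - (1 / 2 - γ) := by
  obtain ⟨j, hj⟩ := h.add_mem t
  have h1 : (0 : ℝ) ≤ F t - ord t / 2 := h.zero ▸ h.le_sub ht
  rw [ho] at hj h1
  simp only [Nat.cast_one] at hj h1
  have h2 : (0 : ℝ) < j := by rcases h.gamma_eq with e | e <;> rw [e] at hj <;> linarith
  have h3 : 0 < j := by exact_mod_cast h2
  lift j to ℕ using h3.le
  refine ⟨j, by omega, ?_⟩
  push_cast at hj
  linarith

/-- By monotonicity a level strictly inside the jump at t can be attained only at t. For t > 0 a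
jump of height at least 2 from i + γ contains the levels of index i + 1 and i + 2, and F t cannot
equal both. At t = 0 it would contain the level of index 1, which is positive, while F 0 = 0. -/
theorem ord_le_one (h : IsStepFunction F ord γ)
    (huniq : ∀ n : ℕ, 1 ≤ n → ∃! t, F t = n - (1 / 2 - γ)) {t : ℝ} (ht : 0 ≤ t) :
    ord t ≤ 1 := by
  by_contra! ho
  have ho' : (2 : ℝ) ≤ ord t := by exact_mod_cast ho
  have key : ∀ n : ℕ, 1 ≤ n → F t - ord t / 2 < n - (1 / 2 - γ) →
      (n : ℝ) - (1 / 2 - γ) < F t + ord t / 2 → F t = n - (1 / 2 - γ) := by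
    intro n hn h1 h2
    obtain ⟨u, hu, -⟩ := huniq n hn
    rcases lt_trichotomy t u with hlt | he | hlt
    · linarith [h.add_le hlt]
    · rw [he, hu]
    · linarith [h.le_sub hlt]
  obtain ⟨j, hj⟩ := h.add_mem t
  rcases ht.eq_or_lt with rfl | hpos
  · rw [h.zero] at hj key
    have hj1 : (1 : ℝ) - γ ≤ j := by linarith
    have hj2 : 1 ≤ j := by
      have : (0 : ℝ) < j := by rcases h.gamma_eq with e | e <;> rw [e] at hj1 <;> linarith
      have : 0 < j := by exact_mod_cast this
      omega
    have hj3 : (1 : ℝ) ≤ j := by exact_mod_cast hj2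
    have := key 1 le_rfl (by push_cast; rcases h.gamma_eq with e | e <;> rw [e] <;> linarith)
      (by push_cast; linarith)
    push_cast at this
    rcases h.gamma_eq with e | e <;> rw [e] at this <;> linarith
  · have h1 : (0 : ℝ) ≤ F t - ord t / 2 := h.zero ▸ h.le_sub hpos
    obtain ⟨i, hi⟩ : ∃ i : ℤ, F t - ord t / 2 = i + γ :=
      ⟨j - ord t, by push_cast; linarith⟩
    have hi0 : (-1 : ℝ) < i := by rcases h.gamma_eq with e | e <;> rw [e] at hi <;> linarith
    have hi1 : -1 < i := by exact_mod_cast hi0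
    -- The lower end of the jump is nonnegative, so i ≥ 0 and both indices i + 1, i + 2 are at least
    -- 1, as the uniqueness assumption requires.
    lift i to ℕ using (by omega)
    push_cast at hi
    have e1 := key (i + 1) (by omega) (by push_cast; linarith) (by push_cast; linarith)
    have e2 := key (i + 2) (by omega) (by push_cast; linarith) (by push_cast; linarith)
    push_cast at e1 e2
    linarith

/-- The enumeration of the points of positive order by the values of the step function. -/
theorem exists_enumeration (h : IsStepFunction F ord γ)
    (hinf : {t | 0 < t ∧ ord t ≠ 0}.Infinite) (hord : ∀ t, ord t ≤ 1) :
    ∃ z : ℕ → ℝ, StrictMonoOn z (Set.Ici 1) ∧ z '' Set.Ici 1 = {t | 0 < t ∧ ord t ≠ 0} ∧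
      ∀ n : ℕ, 1 ≤ n → ∀ t, F t = n - (1 / 2 - γ) ↔ t = z n := by
  have hex : ∀ n : ℕ, ∃ t, 1 ≤ n → F t = n - (1 / 2 - γ) := fun n => by
    by_cases hn : 1 ≤ n
    · obtain ⟨t, ht⟩ := h.exists_eq hinf hord hn
      exact ⟨t, fun _ => ht⟩
    · exact ⟨0, fun h => absurd h hn⟩
  choose z hz using hex
  have hiff : ∀ n : ℕ, 1 ≤ n → ∀ t, F t = n - (1 / 2 - γ) ↔ t = z n := fun n hn t =>
    ⟨fun ht => h.eq_of_eq (n := n) (by exact_mod_cast ht) (by exact_mod_cast hz n hn),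
      fun ht => ht ▸ hz n hn⟩
  refine ⟨z, ?_, ?_, hiff⟩
  · intro a ha b hb hab
    by_contra! hc
    have h1 := h.monotone hc
    rw [hz a ha, hz b hb] at h1
    have : (a : ℝ) < b := by exact_mod_cast hab
    linarith
  · ext t
    constructor
    · rintro ⟨n, hn, rfl⟩
      exact ⟨h.pos_of_eq hn (hz n hn), h.ord_ne_zero (n := n) (by exact_mod_cast hz n hn)⟩
    · rintro ⟨ht, ho⟩
      obtain ⟨n, hn, e⟩ := h.eq_of_ord_eq_one ht
        (le_antisymm (hord t) (Nat.one_le_iff_ne_zero.2 ho))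
      exact ⟨n, hn, ((hiff n hn t).1 e).symm⟩

theorem count (h : IsStepFunction F ord γ)
    (hinf : {t | 0 < t ∧ ord t ≠ 0}.Infinite) (hord : ∀ t, ord t ≤ 1) {T : ℝ} (hT : 0 < T)
    (hoT : ord T = 0) :
    {t | 0 < t ∧ t < T ∧ ∃ n : ℕ, 1 ≤ n ∧ F t = n - (1 / 2 - γ)}.Finite ∧
    ({t | 0 < t ∧ t < T ∧ ∃ n : ℕ, 1 ≤ n ∧ F t = n - (1 / 2 - γ)}.ncard : ℝ) = F T - γ := by
  obtain ⟨z, hmono, -, hiff⟩ := h.exists_enumeration hinf hord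
  have hz : ∀ n : ℕ, 1 ≤ n → F (z n) = n - (1 / 2 - γ) := fun n hn => (hiff n hn _).2 rfl
  obtain ⟨j, hj⟩ := h.plateau T hoT
  have hj0 : (-1 : ℝ) < j := by
    have := h.nonneg hT.le
    rcases h.gamma_eq with e | e <;> rw [e] at hj <;> linarith
  have hj1 : -1 < j := by exact_mod_cast hj0
  lift j to ℕ using (by omega)
  push_cast at hj
  -- With F T = j + γ, the levels passed before T are exactly those of index 1, ..., j.
  have hset : {t | 0 < t ∧ t < T ∧ ∃ n : ℕ, 1 ≤ n ∧ F t = n - (1 / 2 - γ)} =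
      z '' (Finset.Icc 1 j : Set ℕ) := by
    ext t
    simp only [Set.mem_ofPred_eq, Set.mem_image, Finset.coe_Icc, Set.mem_Icc]
    constructor
    · rintro ⟨-, htT, n, hn, e⟩
      refine ⟨n, ⟨hn, ?_⟩, ((hiff n hn t).1 e).symm⟩
      have h1 := h.monotone htT.le
      rw [e, hj] at h1
      have : (n : ℝ) < j + 1 := by linarith
      have : n < j + 1 := by exact_mod_cast this
      omega
    · rintro ⟨n, ⟨hn, hnj⟩, rfl⟩
      refine ⟨h.pos_of_eq hn (hz n hn), ?_, n, hn, hz n hn⟩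
      by_contra! hc
      have h1 := h.monotone hc
      rw [hz n hn, hj] at h1
      have : (n : ℝ) ≤ j := by exact_mod_cast hnj
      linarith
  rw [hset]
  refine ⟨(Finset.finite_toSet _).image _, ?_⟩
  rw [Set.InjOn.ncard_image (hmono.injOn.mono fun n hn => by
    simp only [Finset.coe_Icc, Set.mem_Icc] at hn; exact hn.1), Set.ncard_coe_finset, hj]
  simp

end IsStepFunction

/-! ### Entire functions with finitely many zeros and order below two. -/

open Complex in
/-- An entire function without zeros is the exponential of an entire function. -/
theorem exists_eq_exp_of_ne_zero {g : ℂ → ℂ} (hg : Differentiable ℂ g) (h0 : ∀ z, g z ≠ 0) :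
    ∃ h : ℂ → ℂ, Differentiable ℂ h ∧ ∀ z, g z = exp (h z) := by
  have hd : Differentiable ℂ (fun z => deriv g z / g z) := fun z =>
    (hg.analyticAt z).deriv.differentiableAt.div (hg z) (h0 z)
  -- h is the primitive of g'/g normalised by exp (h 0) = g 0; then g · exp(-h) has derivative zero.
  obtain ⟨h, h00, hh⟩ := hd.isExactOn_univ.with_val_at 0 (log (g 0))
  have hh' : ∀ z, HasDerivAt h (deriv g z / g z) z := fun z => hh z trivial
  refine ⟨h, fun z => (hh' z).differentiableAt, fun z => ?_⟩
  have hq : ∀ z, HasDerivAt (fun w => g w * exp (-h w)) 0 z := by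
    intro z
    refine ((hg z).hasDerivAt.mul ((hh' z).fun_neg.cexp)).congr_deriv ?_
    rw [mul_neg, mul_neg, mul_div_assoc', mul_div_assoc', mul_comm (g z), mul_div_cancel_right₀ _ (h0 z)]
    ring
  have hc := is_const_of_deriv_eq_zero (fun z => (hq z).differentiableAt) (fun z => (hq z).deriv) z 0
  simp only [h00] at hc
  rw [exp_neg, exp_neg, exp_log (h0 0), mul_inv_cancel₀ (h0 0)] at hc
  field_simp [exp_ne_zero] at hc
  exact hc

/-- Removing one zero of an entire function. -/
theorem exists_eq_pow_mul {f : ℂ → ℂ} (hf : Differentiable ℂ f) (hfin : {z | f z = 0}.Finite)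
    (z₀ : ℂ) : ∃ (m : ℕ) (g : ℂ → ℂ), Differentiable ℂ g ∧ (∀ z, f z = (z - z₀) ^ m * g z) ∧
      {z | g z = 0} = {z | f z = 0} \ {z₀} := by
  have hne : ¬ ∀ᶠ z in 𝓝 z₀, f z = 0 := by
    intro hev
    have : {z | f z = 0} ∈ 𝓝 z₀ := hev
    exact infinite_of_mem_nhds z₀ this hfin
  obtain ⟨m, u, hu, hu0, hfu⟩ := (hf.analyticAt z₀).exists_eventuallyEq_pow_smul_nonzero_iff.2 hne
  set g : ℂ → ℂ := fun z => if z = z₀ then u z₀ else f z / (z - z₀) ^ m with hgdef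
  have hgu : g =ᶠ[𝓝 z₀] u := by
    filter_upwards [hfu] with z hz
    by_cases h : z = z₀
    · simp [hgdef, h]
    · have : (z - z₀) ^ m ≠ 0 := pow_ne_zero _ (sub_ne_zero.2 h)
      simp only [hgdef, h, if_false, hz, smul_eq_mul]
      field_simp
  have hg0 : g z₀ = u z₀ := by simp [hgdef]
  have hfg : ∀ z, f z = (z - z₀) ^ m * g z := by
    intro z
    by_cases h : z = z₀
    · rw [h, hg0, hfu.self_of_nhds, smul_eq_mul]
    · have : (z - z₀) ^ m ≠ 0 := pow_ne_zero _ (sub_ne_zero.2 h)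
      simp only [hgdef, h, if_false]
      field_simp
  refine ⟨m, g, fun z => ?_, hfg, ?_⟩
  · by_cases h : z = z₀
    · rw [h]; exact hu.differentiableAt.congr_of_eventuallyEq hgu
    · have hev : g =ᶠ[𝓝 z] fun z => f z / (z - z₀) ^ m := by
        filter_upwards [isOpen_ne.mem_nhds h] with w hw
        have hw' : w ≠ z₀ := hw
        simp [hgdef, hw']
      refine DifferentiableAt.congr_of_eventuallyEq ?_ hev
      exact (hf z).div (by fun_prop) (pow_ne_zero _ (sub_ne_zero.2 h))
  · ext z
    simp only [Set.mem_ofPred_eq, Set.mem_sdiff, Set.mem_singleton_iff]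
    by_cases h : z = z₀
    · simp [h, hg0, hu0]
    · simp [h, hfg z, sub_ne_zero.2 h]

/-- Removing all zeros of an entire function with finitely many of them. -/
theorem exists_eq_mul_of_finite_zeros {f : ℂ → ℂ} (hf : Differentiable ℂ f)
    (hfin : {z | f z = 0}.Finite) :
    ∃ P g : ℂ → ℂ, (∃ C D : ℝ, ∀ z, ‖P z‖ ≤ C * Real.exp (D * ‖z‖)) ∧
      (∃ R : ℝ, ∀ z, R ≤ ‖z‖ → 1 ≤ ‖P z‖) ∧ Differentiable ℂ g ∧ (∀ z, g z ≠ 0) ∧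
      ∀ z, f z = P z * g z := by
  -- Each step strips one zero with its full multiplicity. Of the polynomial factor P only two
  -- bounds are kept: the lower one carries growth from f to g on large circles, the upper one
  -- carries it back.
  induction hn : {z | f z = 0}.ncard using Nat.strong_induction_on generalizing f with
  | _ n ih =>
  by_cases hex : ∃ z₀, f z₀ = 0
  · obtain ⟨z₀, hz₀⟩ := hex
    obtain ⟨m, f₁, hf₁, hff₁, hset⟩ := exists_eq_pow_mul hf hfin z₀
    have hlt : {z | f₁ z = 0}.ncard < n := by
      rw [hset, ← hn]
      exact Set.ncard_sdiff_singleton_lt_of_mem hz₀ hfin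
    obtain ⟨P, g, ⟨C, D, hCD⟩, ⟨R, hR⟩, hg, hg0, hfg⟩ :=
      ih _ hlt hf₁ (hset ▸ hfin.subset Set.sdiff_subset) rfl
    refine ⟨fun z => (z - z₀) ^ m * P z, g, ⟨(1 + ‖z₀‖) ^ m * C, m + D, fun z => ?_⟩,
      ⟨max R (1 + ‖z₀‖), fun z hz => ?_⟩, hg, hg0, fun z => by rw [hff₁, hfg, mul_assoc]⟩
    · have h1 : ‖z - z₀‖ ≤ (1 + ‖z₀‖) * Real.exp ‖z‖ := by
        have h2 := Real.add_one_le_exp ‖z‖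
        have h3 := norm_sub_le z z₀
        nlinarith [norm_nonneg z₀, norm_nonneg z]
      calc ‖(z - z₀) ^ m * P z‖ = ‖z - z₀‖ ^ m * ‖P z‖ := by rw [norm_mul, norm_pow]
        _ ≤ ((1 + ‖z₀‖) * Real.exp ‖z‖) ^ m * (C * Real.exp (D * ‖z‖)) := by
          gcongr; exact hCD z
        _ = (1 + ‖z₀‖) ^ m * C * Real.exp ((m + D) * ‖z‖) := by
          rw [mul_pow, ← Real.exp_nat_mul, add_mul, Real.exp_add]; ring
    · have h1 : 1 ≤ ‖z - z₀‖ := by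
        have := norm_sub_norm_le z z₀
        have := (le_max_right _ _).trans hz
        linarith
      rw [norm_mul, norm_pow]
      exact one_le_mul_of_one_le_of_one_le (one_le_pow₀ h1) (hR z ((le_max_left _ _).trans hz))
  · push Not at hex
    exact ⟨1, f, ⟨1, 0, by simp⟩, ⟨0, by simp⟩, hf, hex, by simp⟩

open Complex Metric in
/-- An entire function whose real part is `o(N²)` on the discs of radius `N` is affine. -/
theorem exists_affine_of_re_le {h : ℂ → ℂ} (hh : Differentiable ℂ h) {M : ℕ → ℝ}
    (hM : Tendsto (fun N : ℕ => M N / (N : ℝ) ^ 2) atTop (𝓝 0))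
    (hre : ∀ᶠ N : ℕ in atTop, ∀ z : ℂ, ‖z‖ < N → (h z).re ≤ M N) :
    ∃ A B : ℂ, ∀ z, h z = A + B * z := by
  have hd1 : Differentiable ℂ (deriv h) := fun z => (hh.analyticAt z).deriv.differentiableAt
  have hdd : ∀ z, deriv (deriv h) z = 0 := by
    intro z
    have hbound : ∀ᶠ N : ℕ in atTop, ‖deriv (deriv h) z‖ ≤
        (2 * (2 * |M N| + 2 + 3 * ‖h 0‖)) * (16 / (N : ℝ) ^ 2) := by
      filter_upwards [hre, eventually_gt_atTop 0,
        eventually_ge_atTop (⌈4 * ‖z‖⌉₊)] with N hN hN0 hNz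
      have hN0' : (0 : ℝ) < N := by exact_mod_cast hN0
      have hz : 4 * ‖z‖ ≤ N := (Nat.le_ceil _).trans (by exact_mod_cast hNz)
      have hbc : ∀ w : ℂ, ‖w‖ ≤ N / 2 → ‖h w‖ ≤ 2 * |M N| + 2 + 3 * ‖h 0‖ := by
        intro w hw
        have hw' : ‖w‖ < N := by linarith
        -- Since ‖w‖ ≤ N/2, the factors of Borel–Carathéodory are at most 2 and 3; the added 1 only
        -- makes the bound on the real part positive.
        have := borelCaratheodory (M := |M N| + 1) (R := N) (f := h) (z := w) (by positivity)
          hh.differentiableOn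
          (fun x hx => ((hN x (by simpa using hx)).trans (le_abs_self _)).trans (by simp))
          hN0' (by simpa using hw')
        have hpos : 0 < (N : ℝ) - ‖w‖ := by linarith
        refine this.trans (add_le_add ?_ ?_)
        · rw [div_le_iff₀ hpos]
          have : (0 : ℝ) ≤ |M N| := abs_nonneg _
          nlinarith
        · rw [div_le_iff₀ hpos]
          nlinarith [norm_nonneg (h 0)]
      -- Cauchy's estimate on radius N/4 gives 2! · 16/N² times the bound, which tends to 0 because
      -- M N = o(N²).
      have hcau := norm_iteratedDeriv_le_of_forall_mem_sphere_norm_le (n := 2) (c := z)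
        (R := (N : ℝ) / 4) (C := 2 * |M N| + 2 + 3 * ‖h 0‖) (F := ℂ) (f := h) (by positivity)
        (hh.diffContOnCl) (fun w hw => hbc w (by
          have h1 : ‖w - z‖ = N / 4 := by simpa [dist_eq_norm] using hw
          have h2 := norm_sub_norm_le w z
          linarith))
      rw [iteratedDeriv_succ, iteratedDeriv_one] at hcau
      refine hcau.trans (le_of_eq ?_)
      have : (N : ℝ) ≠ 0 := hN0'.ne'
      simp only [Nat.factorial]
      push_cast
      field_simp
      ring
    have hlim : Tendsto (fun N : ℕ => (2 * (2 * |M N| + 2 + 3 * ‖h 0‖)) * (16 / (N : ℝ) ^ 2))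
        atTop (𝓝 0) := by
      have h1 : Tendsto (fun N : ℕ => |M N / (N : ℝ) ^ 2|) atTop (𝓝 0) := by
        simpa using hM.abs
      have h2 : Tendsto (fun N : ℕ => ((N : ℝ) ^ 2)⁻¹) atTop (𝓝 0) :=
        ((tendsto_pow_atTop (two_ne_zero)).comp tendsto_natCast_atTop_atTop).inv_tendsto_atTop
      have h3 := (h1.const_mul 64).add (h2.const_mul (32 * (2 + 3 * ‖h 0‖)))
      simp only [mul_zero, add_zero] at h3
      refine h3.congr fun N => ?_
      rw [abs_div, abs_of_nonneg (by positivity : (0 : ℝ) ≤ (N : ℝ) ^ 2)]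
      ring
    exact norm_le_zero_iff.1 (ge_of_tendsto hlim hbound)
  have hc : ∀ z, deriv h z = deriv h 0 := fun z => is_const_of_deriv_eq_zero hd1 hdd z 0
  refine ⟨h 0, deriv h 0, fun z => ?_⟩
  have hq : ∀ w, HasDerivAt (fun w => h w - deriv h 0 * w) 0 w := by
    intro w
    have := (hh w).hasDerivAt.sub ((hasDerivAt_id w).const_mul (deriv h 0))
    rw [hc w] at this
    exact this.congr_deriv (by simp)
  have := is_const_of_deriv_eq_zero (fun z => (hq z).differentiableAt) (fun z => (hq z).deriv) z 0
  simp only [mul_zero, sub_zero] at this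
  linear_combination this

open Complex Metric in
/-- An entire function of order less than two with finitely many zeros grows at most
exponentially. -/
theorem norm_le_exp_of_finite_zeros {f : ℂ → ℂ} (hf : Differentiable ℂ f)
    (hfin : {z | f z = 0}.Finite) {M : ℕ → ℝ}
    (hM : Tendsto (fun N : ℕ => M N / (N : ℝ) ^ 2) atTop (𝓝 0))
    (hle : ∀ᶠ N : ℕ in atTop, ∀ z : ℂ, ‖z‖ ≤ N → ‖f z‖ ≤ Real.exp (M N)) :
    ∃ C D : ℝ, ∀ z, ‖f z‖ ≤ C * Real.exp (D * ‖z‖) := by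
  obtain ⟨P, g, ⟨C, D, hCD⟩, ⟨R, hR⟩, hg, hg0, hfg⟩ := exists_eq_mul_of_finite_zeros hf hfin
  obtain ⟨h, hh, hgh⟩ := exists_eq_exp_of_ne_zero hg hg0
  have hre : ∀ᶠ N : ℕ in atTop, ∀ z : ℂ, ‖z‖ < N → (h z).re ≤ M N := by
    filter_upwards [hle, eventually_ge_atTop ⌈R⌉₊, eventually_gt_atTop 0] with N hN hNR hN0 z hz
    have hN0' : (0 : ℝ) < N := by exact_mod_cast hN0
    have hb : ‖g z‖ ≤ Real.exp (M N) := by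
      -- By the maximum principle it suffices to bound g on the circle ‖w‖ = N, where ‖P‖ ≥ 1 gives
      -- ‖g‖ ≤ ‖f‖.
      refine norm_le_of_forall_mem_frontier_norm_le (U := ball 0 (N : ℝ)) isBounded_ball
        hg.diffContOnCl (fun w hw => ?_) (subset_closure (by simpa using hz))
      rw [frontier_ball _ hN0'.ne'] at hw
      have hw' : ‖w‖ = N := by simpa using hw
      have h1 : 1 ≤ ‖P w‖ := hR w (hw' ▸ (Nat.le_ceil _).trans (by exact_mod_cast hNR))
      calc ‖g w‖ ≤ ‖P w‖ * ‖g w‖ := le_mul_of_one_le_left (norm_nonneg _) h1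
        _ = ‖f w‖ := by rw [hfg, norm_mul]
        _ ≤ _ := hN w hw'.le
    rwa [hgh, norm_exp, Real.exp_le_exp] at hb
  obtain ⟨A, B, hAB⟩ := exists_affine_of_re_le hh hM hre
  refine ⟨C * Real.exp ‖A‖, D + ‖B‖, fun z => ?_⟩
  have hC : 0 ≤ C * Real.exp (D * ‖z‖) := (norm_nonneg _).trans (hCD z)
  have h1 : ‖g z‖ ≤ Real.exp (‖A‖ + ‖B‖ * ‖z‖) := by
    rw [hgh, norm_exp, Real.exp_le_exp, hAB]
    exact (re_le_norm _).trans ((norm_add_le _ _).trans (by rw [norm_mul]))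
  calc ‖f z‖ = ‖P z‖ * ‖g z‖ := by rw [hfg, norm_mul]
    _ ≤ (C * Real.exp (D * ‖z‖)) * Real.exp (‖A‖ + ‖B‖ * ‖z‖) :=
      mul_le_mul (hCD z) h1 (norm_nonneg _) hC
    _ = _ := by rw [add_mul, Real.exp_add, Real.exp_add]; ring

/-! ### Functional equation and reality of the completed L-function. -/

open Complex ComplexConjugate

/-- The completed `L`-function `(2π)^{-s} Γ(s) L_f(s)`. -/
noncomputable def Lam {k : ℤ} (hk : 4 ≤ k) (f : ModularForm 𝒮ℒ k) : ℂ → ℂ :=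
  ModularForm.Λ (lt_of_lt_of_le four_pos hk) f

/-- The pair of functions whose Mellin transform is the completed `L`-function. -/
noncomputable abbrev fePair {k : ℤ} (hk : 4 ≤ k) (f : ModularForm 𝒮ℒ k) : WeakFEPair ℂ :=
  ModularForm.weakFEPair (lt_of_lt_of_le four_pos hk) f

section

variable {k : ℤ} (hk : 4 ≤ k) (f : ModularForm 𝒮ℒ k)

theorem lFun_eq (s : ℂ) : LFun hk f s = Lam hk f s * (2 / Gammaℂ s) := rfl

theorem gammaℂ_ne_zero {s : ℂ} (hs : 0 < s.re) : Gammaℂ s ≠ 0 := by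
  rw [Gammaℂ_def]
  exact mul_ne_zero (mul_ne_zero two_ne_zero (by
    rw [Ne, cpow_eq_zero_iff]; simp [Real.pi_ne_zero])) (Gamma_ne_zero_of_re_pos hs)

theorem lam_eq {s : ℂ} (hs : 0 < s.re) : Lam hk f s = LFun hk f s * (Gammaℂ s / 2) := by
  have := gammaℂ_ne_zero hs
  rw [lFun_eq]; field_simp

theorem coe_translate_S :
    (ModularForm.translate f (ModularGroup.S : GL (Fin 2) ℝ) : UpperHalfPlane → ℂ) = f := by
  rw [ModularForm.coe_translate]
  exact SlashInvariantFormClass.slash_action_eq f _ ⟨ModularGroup.S, rfl⟩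

theorem fePair_g : (fePair hk f).g = (fePair hk f).f := by
  ext t
  simp only [ModularForm.weakFEPair_g, ModularForm.weakFEPair_f]
  exact congrFun (coe_translate_S f) _

theorem fePair_g₀ : (fePair hk f).g₀ = (fePair hk f).f₀ := by
  simp only [ModularForm.weakFEPair_g₀, ModularForm.weakFEPair_f₀]
  rw [coe_translate_S]

theorem fePair_f₀ : (fePair hk f).f₀ = qCoeff f 0 := by
  simp only [ModularForm.weakFEPair_f₀]
  exact (UpperHalfPlane.qExpansion_coeff_zero one_pos
    (ModularFormClass.analyticAt_cuspFunction_zero f one_pos one_mem_strictPeriods_SL)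
    (SlashInvariantFormClass.periodic_comp_ofComplex f one_mem_strictPeriods_SL)).symm

variable (hev : Even k)

include hev in
theorem fePair_ε : (fePair hk f).ε = (-1) ^ (k / 2) := by
  obtain ⟨j, rfl⟩ := hev
  have : (j + j) / 2 = j := by omega
  simp only [ModularForm.weakFEPair_ε]
  rw [this, ← two_mul, zpow_mul]
  congr 1
  simp

theorem conj_neg_one_zpow (j : ℤ) : conj ((-1 : ℂ) ^ j) = (-1) ^ j := by
  simp [map_zpow₀]

theorem neg_one_zpow_inv (j : ℤ) : ((-1 : ℂ) ^ j)⁻¹ = (-1) ^ j := by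
  rw [← inv_zpow]; norm_num

-- In level one f is fixed by S, and ε = ±1 is its own inverse. The functional equation pair
-- therefore coincides with its dual and relates Λ to itself.
include hev in
theorem lam_sub (s : ℂ) : Lam hk f (k - s) = (-1) ^ (k / 2) * Lam hk f s := by
  have h := (fePair hk f).functional_equation s
  have hε := fePair_ε hk f hev
  have hsymm : (fePair hk f).symm.Λ = (fePair hk f).Λ := by
    have h1 : (fePair hk f).symm.ε = (fePair hk f).ε := by
      rw [WeakFEPair.symm_ε, hε, neg_one_zpow_inv]
    have h2 : (fePair hk f).symm.f = (fePair hk f).f := fePair_g hk f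
    have h3 : (fePair hk f).symm.g = (fePair hk f).g := (fePair_g hk f).symm
    have h4 : (fePair hk f).symm.f₀ = (fePair hk f).f₀ := fePair_g₀ hk f
    have h5 : (fePair hk f).symm.g₀ = (fePair hk f).g₀ := (fePair_g₀ hk f).symm
    have h6 : (fePair hk f).symm.k = (fePair hk f).k := rfl
    ext s
    simp only [WeakFEPair.Λ, WeakFEPair.Λ₀, WeakFEPair.f_modif, h1, h2, h4, h5, h6]
  rw [hsymm, hε] at h
  simpa [Lam, ModularForm.Λ] using h

variable (hreal : ∀ n : ℕ, (qCoeff f n).im = 0)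

include hreal in
theorem conj_qCoeff (n : ℕ) : conj (qCoeff f n) = qCoeff f n :=
  conj_eq_iff_im.2 (hreal n)

-- On the imaginary axis q = e^{-2πt} is real, so a series in q with real coefficients is real.
include hreal in
theorem conj_fePair_f {t : ℝ} (ht : 0 < t) : conj ((fePair hk f).f t) = (fePair hk f).f t := by
  have h := ModularForm.hasSum_qExpansion f one_pos one_mem_strictPeriods_SL
    (UpperHalfPlane.ofComplex (I * t))
  refine (Complex.hasSum_conj'.2 h).unique ?_
  have hfun : (fePair hk f).f t = f (UpperHalfPlane.ofComplex (I * t)) := rfl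
  rw [hfun]
  convert h using 2 with n
  have hq : conj (Function.Periodic.qParam 1 (UpperHalfPlane.ofComplex (I * t))) =
      Function.Periodic.qParam 1 (UpperHalfPlane.ofComplex (I * t)) := by
    rw [UpperHalfPlane.ofComplex_apply_of_im_pos (by simpa using ht)]
    simp only [Function.Periodic.qParam, ← exp_conj]
    congr 1
    simp only [map_div₀, map_mul, conj_I, conj_ofReal, map_ofNat]
    ring
  rw [map_mul, map_pow, hq]
  congr 1
  exact conj_qCoeff f hreal n

theorem mellin_conj {g : ℝ → ℂ} (hg : ∀ t, 0 < t → conj (g t) = g t) (s : ℂ) :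
    mellin g (conj s) = conj (mellin g s) := by
  rw [mellin, mellin, ← integral_conj]
  refine MeasureTheory.setIntegral_congr_fun measurableSet_Ioi fun t ht => ?_
  have ht' : (0 : ℝ) < t := ht
  simp only [smul_eq_mul, map_mul, hg t ht']
  congr 1
  have := cpow_conj (t : ℂ) (s - 1) (by rw [arg_ofReal_of_nonneg ht'.le]; exact Real.pi_pos.ne)
  simpa using this

-- Λ is the Mellin transform of a real function minus polar terms with real coefficients.
include hev hreal in
theorem lam_conj (s : ℂ) : Lam hk f (conj s) = conj (Lam hk f s) := by
  have hf₀ : conj (fePair hk f).f₀ = (fePair hk f).f₀ := by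
    rw [fePair_f₀]; exact conj_qCoeff f hreal 0
  have hε : conj (fePair hk f).ε = (fePair hk f).ε := by
    rw [fePair_ε hk f hev, conj_neg_one_zpow]
  have hm : (fePair hk f).Λ₀ (conj s) = conj ((fePair hk f).Λ₀ s) := by
    refine mellin_conj (fun t ht => ?_) s
    have h1 := conj_fePair_f hk f hreal ht
    simp only [WeakFEPair.f_modif, Pi.add_apply, Set.indicator_apply, fePair_g₀, smul_eq_mul]
    split_ifs <;> simp only [map_add, map_sub, map_mul, h1, hf₀, hε, conj_ofReal, map_zero]
  have hk' : conj ((fePair hk f).k : ℂ) = (fePair hk f).k := conj_ofReal _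
  simp only [Lam, ModularForm.Λ]
  change (fePair hk f).Λ _ = conj ((fePair hk f).Λ _)
  simp only [WeakFEPair.Λ, hm, fePair_g₀, smul_eq_mul, map_sub, map_mul, map_div₀, hf₀, hε, hk',
    map_one]

end

/-! ### Phases of real and of purely imaginary numbers. -/

theorem exists_eq_int_mul_pi {w : ℂ} {R x : ℝ} (hR : 0 < R) (hw : w = R * exp (x * I))
    (hc : conj w = w) : ∃ n : ℤ, x = n * Real.pi := by
  have h1 : w.im = 0 := conj_eq_iff_im.1 hc
  rw [hw, exp_mul_I, ← ofReal_cos, ← ofReal_sin] at h1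
  simp [hR.ne'] at h1
  obtain ⟨n, hn⟩ := Real.sin_eq_zero_iff.1 h1
  exact ⟨n, hn.symm⟩

theorem exists_eq_half_int_mul_pi {w : ℂ} {R x : ℝ} (hR : 0 < R) (hw : w = R * exp (x * I))
    (hc : conj w = -w) : ∃ n : ℤ, x = (n + 1 / 2) * Real.pi := by
  have h1 : w.re = 0 := by
    have := congrArg re hc
    simp at this
    linarith
  rw [hw, exp_mul_I, ← ofReal_cos, ← ofReal_sin] at h1
  simp [hR.ne'] at h1
  obtain ⟨n, hn⟩ := Real.cos_eq_zero_iff.1 h1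
  exact ⟨n, by rw [hn]; ring⟩

theorem phase_of_conj_eq {w : ℂ} {R x : ℝ} (j : ℤ) (hR : 0 < R) (hw : w = R * exp (x * I))
    (hc : conj w = (-1) ^ j * w) :
    ∃ n : ℤ, x = (n + (1 - (-1 : ℝ) ^ j) / 4) * Real.pi := by
  rcases j.even_or_odd with hj | hj
  · rw [hj.neg_one_zpow, one_mul] at hc
    obtain ⟨n, hn⟩ := exists_eq_int_mul_pi hR hw hc
    exact ⟨n, by rw [hj.neg_one_zpow, hn]; ring⟩
  · rw [hj.neg_one_zpow, neg_one_mul] at hc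
    obtain ⟨n, hn⟩ := exists_eq_half_int_mul_pi hR hw hc
    exact ⟨n, by rw [hj.neg_one_zpow, hn]; ring⟩

theorem phase_of_conj_eq_neg {w : ℂ} {R x : ℝ} (j : ℤ) (hR : 0 < R) (hw : w = R * exp (x * I))
    (hc : conj w = -((-1) ^ j * w)) :
    ∃ n : ℤ, x = (n - (1 + (-1 : ℝ) ^ j) / 4) * Real.pi := by
  rcases j.even_or_odd with hj | hj
  · rw [hj.neg_one_zpow, one_mul] at hc
    obtain ⟨n, hn⟩ := exists_eq_half_int_mul_pi hR hw hc
    -- (n + 1/2)π is rewritten as ((n + 1) - 1/2)π.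
    exact ⟨n + 1, by rw [hj.neg_one_zpow, hn]; push_cast; ring⟩
  · rw [hj.neg_one_zpow, neg_one_mul, neg_neg] at hc
    obtain ⟨n, hn⟩ := exists_eq_int_mul_pi hR hw hc
    exact ⟨n, by rw [hj.neg_one_zpow, hn]; ring⟩

/-- `ℤ + (1 - (-1)^j)/4` and `ℤ - (1 + (-1)^j)/4` are disjoint. -/
theorem int_add_ne_int_sub (j n m : ℤ) :
    (n + (1 - (-1 : ℝ) ^ j) / 4) * Real.pi ≠ (m - (1 + (-1 : ℝ) ^ j) / 4) * Real.pi := by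
  intro h
  have h1 := mul_right_cancel₀ Real.pi_ne_zero h
  have h2 : ((2 * n + 1 : ℤ) : ℝ) = ((2 * m : ℤ) : ℝ) := by push_cast; linarith
  have h3 : 2 * n + 1 = 2 * m := by exact_mod_cast h2
  omega

/-! ### The continuous argument of Γ on a vertical line. -/

section Gamma

variable {a : ℝ} (ha : 0 < a)

include ha in
theorem add_mul_I_ne_neg (u : ℝ) (m : ℕ) : (a : ℂ) + u * I ≠ -m := by
  intro h
  have := congrArg re h
  simp at this
  have : (0 : ℝ) ≤ m := Nat.cast_nonneg m
  linarith

include ha in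
theorem continuous_digamma_line : Continuous fun u : ℝ => digamma ((a : ℂ) + u * I) := by
  refine continuous_iff_continuousAt.2 fun u => ?_
  have han : AnalyticAt ℂ Gamma ((a : ℂ) + u * I) := by
    have hopen : IsOpen {s : ℂ | 0 < s.re} := isOpen_lt continuous_const continuous_re
    refine DifferentiableOn.analyticAt (s := {s : ℂ | 0 < s.re}) (fun s hs => ?_)
      (hopen.mem_nhds (by simpa using ha))
    refine (differentiableAt_Gamma s fun m h => ?_).differentiableWithinAt
    rw [h] at hs
    have : (0 : ℝ) ≤ m := Nat.cast_nonneg m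
    simp at hs
    linarith
  have hd : ContinuousAt digamma ((a : ℂ) + u * I) := by
    rw [digamma_def]
    exact han.deriv.continuousAt.div han.continuousAt
      (Gamma_ne_zero (add_mul_I_ne_neg ha u))
  exact ContinuousAt.comp (f := fun u : ℝ => (a : ℂ) + u * I) hd (by fun_prop)

-- The derivative of Γ(a + iu) along the line is iψ times itself, so dividing by the exponential
-- leaves a constant.
include ha in
theorem Gamma_eq_exp_integral_digamma (t : ℝ) :
    Gamma ((a : ℂ) + t * I) = Gamma a * exp (I * ∫ u in (0 : ℝ)..t, digamma ((a : ℂ) + u * I)) := by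
  have hc := continuous_digamma_line ha
  have hline : ∀ u : ℝ, HasDerivAt (fun u : ℝ => (a : ℂ) + u * I) I u := fun u => by
    have h := ((hasDerivAt_id u).ofReal_comp.mul_const I).const_add (a : ℂ)
    simpa using h
  have hq : ∀ u : ℝ, HasDerivAt (fun u : ℝ => Gamma ((a : ℂ) + u * I) *
      exp (-(I * ∫ v in (0 : ℝ)..u, digamma ((a : ℂ) + v * I)))) 0 u := by
    intro u
    have h0 := Gamma_ne_zero (add_mul_I_ne_neg ha u)
    have h1 := (differentiableAt_Gamma _ (add_mul_I_ne_neg ha u)).hasDerivAt.comp_of_eq u (hline u) rfl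
    have h2 : HasDerivAt (fun u : ℝ => ∫ v in (0 : ℝ)..u, digamma ((a : ℂ) + v * I))
        (digamma ((a : ℂ) + u * I)) u :=
      intervalIntegral.integral_hasDerivAt_right (hc.intervalIntegrable _ _)
        (hc.stronglyMeasurableAtFilter _ _) hc.continuousAt
    have h3 := (h2.const_mul I).fun_neg.cexp
    refine (h1.mul h3).congr_deriv ?_
    have : Gamma ((a : ℂ) + u * I) * digamma (a + u * I) = deriv Gamma (a + u * I) := by
      rw [digamma_def, logDeriv_apply]; exact mul_div_cancel₀ _ h0
    simp only [Function.comp_apply]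
    linear_combination (-I * exp (-(I * ∫ v in (0 : ℝ)..u, digamma ((a : ℂ) + v * I)))) * this
  have hconst := is_const_of_deriv_eq_zero (fun u => (hq u).differentiableAt)
    (fun u => (hq u).deriv) t 0
  simp only [intervalIntegral.integral_same, mul_zero, neg_zero, exp_zero, mul_one, ofReal_zero,
    zero_mul, add_zero] at hconst
  rw [← hconst, exp_neg, mul_assoc, inv_mul_cancel₀ (exp_ne_zero _), mul_one]

include ha in
theorem Gamma_eq_norm_mul_exp_argGamma (t : ℝ) :
    ∃ r : ℝ, 0 < r ∧ Gamma ((a : ℂ) + t * I) = r * exp (argGamma a t * I) := by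
  have hc := continuous_digamma_line ha
  set J := ∫ u in (0 : ℝ)..t, digamma ((a : ℂ) + u * I) with hJ
  have hre : J.re = argGamma a t := by
    rw [hJ, argGamma]
    exact (reCLM.intervalIntegral_comp_comm (hc.intervalIntegrable _ _)).symm
  -- Multiplication by I turns the real part of the integral into the phase and its imaginary part
  -- into the modulus.
  refine ⟨Real.Gamma a * Real.exp (-J.im), mul_pos (Real.Gamma_pos_of_pos ha) (Real.exp_pos _), ?_⟩
  rw [Gamma_eq_exp_integral_digamma ha, ← hJ, Gamma_ofReal, ofReal_mul, mul_assoc, ofReal_exp,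
    ← exp_add, ← hre]
  congr 2
  conv_lhs => rw [← re_add_im J]
  push_cast
  linear_combination (J.im : ℂ) * I_mul_I

include ha in
theorem continuous_argGamma : Continuous (argGamma a) := by
  have hc : Continuous fun u : ℝ => (digamma ((a : ℂ) + u * I)).re :=
    continuous_re.comp (continuous_digamma_line ha)
  exact intervalIntegral.continuous_primitive (fun _ _ => hc.intervalIntegrable _ _) 0

end Gamma

/-! ### The phase of Λ on the critical line. -/

section

variable {k : ℤ} (hk : 4 ≤ k)

include hk in
theorem half_pos_real : (0 : ℝ) < (k : ℝ) / 2 := by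
  have : (4 : ℝ) ≤ k := by exact_mod_cast hk
  linarith

theorem critPt_eq (k : ℤ) (t : ℝ) : critPt k t = (((k : ℝ) / 2 : ℝ) : ℂ) + t * I := by
  simp [critPt]

theorem critPt_re (k : ℤ) (t : ℝ) : (critPt k t).re = (k : ℝ) / 2 := by
  rw [critPt_eq]; simp [-ofReal_div, -ofReal_intCast]

include hk in
theorem continuous_theta : Continuous (theta k) := by
  unfold theta
  exact (continuous_argGamma (half_pos_real hk)).sub (by fun_prop)

theorem theta_zero (k : ℤ) : theta k 0 = 0 := by simp [theta, argGamma]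

include hk in
theorem gammaℂ_critPt (t : ℝ) :
    ∃ r : ℝ, 0 < r ∧ Gammaℂ (critPt k t) / 2 = r * exp (theta k t * I) := by
  obtain ⟨r, hr, h⟩ := Gamma_eq_norm_mul_exp_argGamma (half_pos_real hk) t
  have h2pi : (0 : ℝ) < 2 * Real.pi := by positivity
  refine ⟨Real.exp (-(Real.log (2 * Real.pi) * ((k : ℝ) / 2))) * r,
    mul_pos (Real.exp_pos _) hr, ?_⟩
  have hcpow : (2 * Real.pi : ℂ) ^ (-critPt k t) =
      exp ((-(Real.log (2 * Real.pi) * ((k : ℝ) / 2)) : ℝ) : ℂ) *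
        exp ((-(t * Real.log (2 * Real.pi)) : ℝ) * I) := by
    rw [show (2 * Real.pi : ℂ) = ((2 * Real.pi : ℝ) : ℂ) by push_cast; rfl,
      cpow_def_of_ne_zero (ofReal_ne_zero.2 h2pi.ne'), ← ofReal_log h2pi.le, ← exp_add, critPt_eq]
    congr 1
    push_cast
    ring
  rw [Gammaℂ_def, hcpow, critPt_eq, h, ofReal_mul _ r, ofReal_exp, theta]
  rw [show ((argGamma ((k : ℝ) / 2) t - t * Real.log (2 * Real.pi) : ℝ) : ℂ) * I =
    ((-(t * Real.log (2 * Real.pi)) : ℝ) : ℂ) * I + argGamma ((k : ℝ) / 2) t * I by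
      push_cast; ring, exp_add]
  ring

variable (f : ModularForm 𝒮ℒ k)

theorem differentiableAt_lam {s : ℂ} (h0 : s ≠ 0) (hsk : s ≠ k ∨ qCoeff f 0 = 0) :
    DifferentiableAt ℂ (Lam hk f) s := by
  refine (fePair hk f).differentiableAt_Λ (.inl h0) ?_
  rw [fePair_g₀, fePair_f₀]
  simpa using hsk

theorem differentiableAt_lFun {s : ℂ} (h0 : s ≠ 0) (hsk : s ≠ k ∨ qCoeff f 0 = 0) :
    DifferentiableAt ℂ (LFun hk f) s := by
  have h1 := differentiableAt_lam hk f h0 hsk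
  have h2 : LFun hk f = fun s => Lam hk f s * (2 * (Gammaℂ s)⁻¹) := by
    ext s; rw [lFun_eq, div_eq_mul_inv]
  rw [h2]
  exact h1.mul ((differentiable_Gammaℂ_inv s).const_mul 2)

include hk in
theorem critPt_ne_zero (t : ℝ) : critPt k t ≠ 0 := fun h => by
  have h1 := critPt_re k t
  rw [h, zero_re] at h1
  linarith [half_pos_real hk]

include hk in
theorem critPt_ne (t : ℝ) : critPt k t ≠ k := fun h => by
  have h1 := critPt_re k t
  rw [h, intCast_re] at h1
  linarith [half_pos_real hk]

theorem differentiableAt_lFun_critPt (t : ℝ) : DifferentiableAt ℂ (LFun hk f) (critPt k t) :=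
  differentiableAt_lFun hk f (critPt_ne_zero hk t) (.inl (critPt_ne hk t))

variable (hev : Even k) (hreal : ∀ n : ℕ, (qCoeff f n).im = 0)

include hev hreal in
theorem conj_lam_critPt (t : ℝ) :
    conj (Lam hk f (critPt k t)) = (-1) ^ (k / 2) * Lam hk f (critPt k t) := by
  rw [← lam_conj hk f hev hreal, ← lam_sub hk f hev]
  congr 1
  simp only [critPt, map_add, map_div₀, map_mul, conj_I, conj_ofReal, map_ofNat, map_intCast]
  ring

theorem lam_critPt (t : ℝ) :
    Lam hk f (critPt k t) = LFun hk f (critPt k t) * (Gammaℂ (critPt k t) / 2) :=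
  lam_eq hk f (by rw [critPt_re]; exact half_pos_real hk)

include hev hreal in
theorem phase_of_ne_zero {t ℓ R : ℝ} (hR : 0 < R) (h : LFun hk f (critPt k t) = R * exp (ℓ * I)) :
    ∃ n : ℤ, theta k t + ℓ = (n + (1 - (-1 : ℝ) ^ (k / 2)) / 4) * Real.pi := by
  obtain ⟨r, hr, hG⟩ := gammaℂ_critPt hk t
  refine phase_of_conj_eq (w := Lam hk f (critPt k t)) (R := R * r) (k / 2) (mul_pos hR hr) ?_
    (conj_lam_critPt hk f hev hreal t)
  rw [lam_critPt, h, hG]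
  push_cast
  rw [add_mul, exp_add]
  ring

theorem hasDerivAt_critPt (t : ℝ) : HasDerivAt (critPt k) I t := by
  have h := ((hasDerivAt_id t).ofReal_comp.mul_const I).const_add ((k : ℂ) / 2)
  rw [ofReal_one, one_mul] at h
  exact h

-- Differentiating conj Λ = (-1)^{k/2} Λ in t gives the same relation for iΛ', hence the opposite
-- sign for Λ'. At a zero Λ' is L' times the Gamma factor, so its phase is ϑ + ℓ.
include hev hreal in
theorem phase_of_simple_zero {t ℓ R : ℝ} (hR : 0 < R) (h0 : LFun hk f (critPt k t) = 0)
    (h : deriv (LFun hk f) (critPt k t) = R * exp (ℓ * I)) :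
    ∃ n : ℤ, theta k t + ℓ = (n - (1 + (-1 : ℝ) ^ (k / 2)) / 4) * Real.pi := by
  obtain ⟨r, hr, hG⟩ := gammaℂ_critPt hk t
  have hre : 0 < (critPt k t).re := by rw [critPt_re]; exact half_pos_real hk
  have hGd : DifferentiableAt ℂ (fun s => Gammaℂ s / 2) (critPt k t) := by
    have : Gammaℂ = fun s => ((Gammaℂ s)⁻¹)⁻¹ := by ext s; simp
    rw [this]
    exact ((differentiable_Gammaℂ_inv _).fun_inv (inv_ne_zero (gammaℂ_ne_zero hre))).div_const 2
  set w := deriv (LFun hk f) (critPt k t) * (Gammaℂ (critPt k t) / 2) with hw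
  have hΛ : HasDerivAt (Lam hk f) w (critPt k t) := by
    have h1 := (differentiableAt_lFun_critPt hk f t).hasDerivAt.fun_mul hGd.hasDerivAt
    rw [h0, zero_mul, add_zero] at h1
    refine h1.congr_of_eventuallyEq ?_
    filter_upwards [(isOpen_lt continuous_const continuous_re).mem_nhds hre] with s hs
    exact lam_eq hk f hs
  have hV : HasDerivAt (fun u : ℝ => Lam hk f (critPt k u)) (w * I) t :=
    hΛ.comp t (hasDerivAt_critPt t)
  have hV2 : HasDerivAt (fun u : ℝ => conj (Lam hk f (critPt k u))) (conj (w * I)) t :=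
    hV.star
  have hV3 : HasDerivAt (fun u : ℝ => conj (Lam hk f (critPt k u))) ((-1) ^ (k / 2) * (w * I)) t := by
    simp_rw [conj_lam_critPt hk f hev hreal]
    exact hV.const_mul _
  have he := hV2.unique hV3
  refine phase_of_conj_eq_neg (w := w) (R := R * r) (k / 2) (mul_pos hR hr) ?_ ?_
  · rw [hw, h, hG]
    push_cast
    rw [add_mul, exp_add]
    ring
  · rw [map_mul, conj_I] at he
    have hI := I_mul_I
    linear_combination I * he + (conj w + (-1) ^ (k / 2) * w) * hI

variable {t ℓ : ℝ}

theorem ray_tendsto (k : ℤ) (t : ℝ) :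
    Tendsto (fun σ : ℝ => (σ : ℂ) + t * I) (𝓝[>] ((k : ℝ) / 2)) (𝓝 (critPt k t)) := by
  rw [critPt_eq]
  have : Continuous fun σ : ℝ => (σ : ℂ) + t * I := by fun_prop
  exact this.continuousAt.tendsto.mono_left nhdsWithin_le_nhds

theorem HasArgLimit.lFun_eq (h : HasArgLimit hk f t ℓ) :
    LFun hk f (critPt k t) = ‖LFun hk f (critPt k t)‖ * exp (ℓ * I) := by
  obtain ⟨φ, -, hφ, -, hlim⟩ := h
  have h1 := (differentiableAt_lFun_critPt hk f t).continuousAt.tendsto.comp (ray_tendsto k t)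
  have h2 : Tendsto (fun σ : ℝ => exp ((φ σ : ℂ) * I)) (𝓝[>] ((k : ℝ) / 2)) (𝓝 (exp (ℓ * I))) := by
    have : Continuous fun x : ℝ => exp ((x : ℂ) * I) := by fun_prop
    exact (this.tendsto ℓ).comp hlim
  have h3 := ((continuous_ofReal.tendsto _).comp h1.norm).mul h2
  refine tendsto_nhds_unique h1 (h3.congr' ?_)
  filter_upwards [self_mem_nhdsWithin] with σ hσ
  exact (hφ σ hσ).2.symm

/-- Along the horizontal ray the increment σ - k/2 is positive, so the difference quotient at a zero
has the same argument as L itself. -/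
theorem HasArgLimit.deriv_eq (h : HasArgLimit hk f t ℓ) (h0 : LFun hk f (critPt k t) = 0) :
    deriv (LFun hk f) (critPt k t) = ‖deriv (LFun hk f) (critPt k t)‖ * exp (ℓ * I) := by
  obtain ⟨φ, -, hφ, -, hlim⟩ := h
  have hd := (differentiableAt_lFun_critPt hk f t).hasDerivAt.tendsto_slope
  have hray : Tendsto (fun σ : ℝ => (σ : ℂ) + t * I) (𝓝[>] ((k : ℝ) / 2)) (𝓝[≠] (critPt k t)) := by
    refine tendsto_nhdsWithin_iff.2 ⟨ray_tendsto k t, ?_⟩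
    filter_upwards [self_mem_nhdsWithin] with σ hσ he
    have := congrArg re he
    rw [critPt_re] at this
    simp at this
    exact (ne_of_gt hσ) this
  have h1 := hd.comp hray
  have h2 : Tendsto (fun σ : ℝ => exp ((φ σ : ℂ) * I)) (𝓝[>] ((k : ℝ) / 2)) (𝓝 (exp (ℓ * I))) := by
    have : Continuous fun x : ℝ => exp ((x : ℂ) * I) := by fun_prop
    exact (this.tendsto ℓ).comp hlim
  have h3 := ((continuous_ofReal.tendsto _).comp h1.norm).mul h2
  refine tendsto_nhds_unique h1 (h3.congr' ?_)
  filter_upwards [self_mem_nhdsWithin] with σ hσ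
  have hσ' : 0 < σ - (k : ℝ) / 2 := sub_pos.2 hσ
  have e : (σ : ℂ) + t * I - critPt k t = ((σ - (k : ℝ) / 2 : ℝ) : ℂ) := by
    rw [critPt_eq]; push_cast; ring
  simp only [Function.comp_apply, slope_def_field, h0, sub_zero, e, norm_div, norm_real,
    Real.norm_of_nonneg hσ'.le]
  rw [(hφ σ hσ).2]
  simp only [norm_mul, norm_real, norm_norm, norm_exp_ofReal_mul_I, mul_one]
  push_cast
  ring

include hev hreal in
/-- Each ordinate separately. -/
theorem zeros_of_argLimit (h : HasArgLimit hk f t ℓ) :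
    (IsSimpleZero hk f t →
      ∃ n : ℤ, theta k t + ℓ = ((n : ℝ) - (1 + (-1 : ℝ) ^ (k / 2)) / 4) * Real.pi) ∧
    ((∃ n : ℤ, theta k t + ℓ = ((n : ℝ) - (1 + (-1 : ℝ) ^ (k / 2)) / 4) * Real.pi) →
      LFun hk f (critPt k t) = 0) := by
  constructor
  · rintro ⟨h0, hd⟩
    exact phase_of_simple_zero hk f hev hreal (norm_pos_iff.2 hd) h0 (h.deriv_eq hk f h0)
  · rintro ⟨n, hn⟩
    by_contra h0
    obtain ⟨m, hm⟩ := phase_of_ne_zero hk f hev hreal (norm_pos_iff.2 h0) (h.lFun_eq hk f)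
    exact int_add_ne_int_sub _ _ _ (hm.symm.trans hn)

end

/-! ### Continuous arguments. -/

/-- If two values differed, the intermediate value theorem would produce a value 1/2 above one of
them, outside the coset ℤ + α. -/
theorem eq_of_continuousOn_of_int {X : Type*} [TopologicalSpace X] {s : Set X}
    (hs : IsPreconnected s) {g : X → ℝ} (hg : ContinuousOn g s) {α : ℝ}
    (hint : ∀ x ∈ s, ∃ n : ℤ, g x = n + α) {x y : X} (hx : x ∈ s) (hy : y ∈ s) : g x = g y := by
  have key : ∀ {x y : X}, x ∈ s → y ∈ s → ¬ g x < g y := by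
    intro x y hx hy hlt
    obtain ⟨n, hn⟩ := hint x hx
    obtain ⟨m, hm⟩ := hint y hy
    have hnm : (n : ℝ) < m := by linarith
    have hnm' : n + 1 ≤ m := by have : n < m := by exact_mod_cast hnm
                                omega
    have hnm'' : (n : ℝ) + 1 ≤ m := by exact_mod_cast hnm'
    obtain ⟨z, hz, he⟩ := hs.intermediate_value hx hy hg
      (show g x + 1 / 2 ∈ Set.Icc (g x) (g y) from ⟨by linarith, by linarith⟩)
    obtain ⟨j, hj⟩ := hint z hz
    have h1 : ((2 * n + 1 : ℤ) : ℝ) = ((2 * j : ℤ) : ℝ) := by push_cast; linarith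
    have h2 : 2 * n + 1 = 2 * j := by exact_mod_cast h1
    omega
  exact le_antisymm (not_lt.1 (key hy hx)) (not_lt.1 (key hx hy))

theorem exists_int_of_arg {z : ℂ} (hz : z ≠ 0) {A B : ℝ} (hA : z = ‖z‖ * exp (A * I))
    (hB : z = ‖z‖ * exp (B * I)) : ∃ n : ℤ, (A - B) / (2 * Real.pi) = n + 0 := by
  have hn : (‖z‖ : ℂ) ≠ 0 := ofReal_ne_zero.2 (norm_ne_zero_iff.2 hz)
  obtain ⟨n, h⟩ := exp_eq_exp_iff_exists_int.1 (mul_left_cancel₀ hn (hA.symm.trans hB))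
  refine ⟨n, ?_⟩
  have h1 : (A : ℂ) = (B + n * (2 * Real.pi) : ℝ) := by
    apply mul_right_cancel₀ I_ne_zero
    rw [h]; push_cast; ring
  have h2 : A = B + n * (2 * Real.pi) := by exact_mod_cast h1
  have := Real.pi_ne_zero
  rw [h2]
  field_simp
  ring

/-- Two continuous arguments on a connected set differ by a constant. -/
theorem arg_sub_eq {X : Type*} [TopologicalSpace X] {s : Set X} (hs : IsPreconnected s)
    {L : X → ℂ} (hL : ∀ x ∈ s, L x ≠ 0) {A B : X → ℝ} (hA : ContinuousOn A s)
    (hB : ContinuousOn B s) (hLA : ∀ x ∈ s, L x = ‖L x‖ * exp (A x * I))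
    (hLB : ∀ x ∈ s, L x = ‖L x‖ * exp (B x * I)) {x y : X} (hx : x ∈ s) (hy : y ∈ s) :
    A x - B x = A y - B y := by
  have h := eq_of_continuousOn_of_int hs (g := fun x => (A x - B x) / (2 * Real.pi))
    ((hA.sub hB).div_const _) (fun x hx => exists_int_of_arg (hL x hx) (hLA x hx) (hLB x hx)) hx hy
  have := Real.pi_ne_zero
  field_simp at h
  exact h

theorem eq_norm_mul_exp_arg_add {z w : ℂ} {x y : ℝ} (hz : z = ‖z‖ * exp (x * I))
    (hw : w = ‖w‖ * exp (y * I)) : z * w = ‖z * w‖ * exp ((x + y : ℝ) * I) := by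
  rw [norm_mul]
  conv_lhs => rw [hz, hw]
  push_cast
  rw [add_mul, exp_add]
  ring

theorem pow_eq_norm_mul_exp {z : ℂ} {x : ℝ} (hz : z = ‖z‖ * exp (x * I)) (n : ℕ) :
    z ^ n = ‖z ^ n‖ * exp ((n * x : ℝ) * I) := by
  rw [norm_pow]
  conv_lhs => rw [hz]
  rw [mul_pow, ← exp_nat_mul]
  push_cast
  ring_nf

theorem isSimplyConnected_of_convex {s : Set ℂ} (hs : Convex ℝ s) (hne : s.Nonempty) :
    IsSimplyConnected s := by
  have := hs.contractibleSpace hne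
  exact (inferInstance : SimplyConnectedSpace s)

/-- A continuous argument in a half-plane for a function asymptotic to `a b^{-s}`. -/
theorem exists_continuous_arg {c : ℝ} {L : ℂ → ℂ} (hLc : ContinuousOn L {s | c < s.re})
    (hL0 : ∀ s : ℂ, c < s.re → L s ≠ 0) {a b : ℝ} (ha : 0 < a)
    (hlim : ∀ ε > 0, ∃ σ₀ : ℝ, ∀ s : ℂ, σ₀ < s.re → ‖L s * exp (s * b) / a - 1‖ < ε) :
    ∃ A : ℂ → ℝ, ContinuousOn A {s | c < s.re} ∧
      (∀ s : ℂ, c < s.re → L s = ‖L s‖ * exp (A s * I)) ∧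
      ∀ t : ℝ, Tendsto (fun σ : ℝ => A (σ + t * I)) atTop (𝓝 (-(t * b))) := by
  set D : Set ℂ := {s | c < s.re} with hD
  have hDo : IsOpen D := isOpen_lt continuous_const continuous_re
  have hDc : Convex ℝ D := convex_halfSpace_re_gt c
  have hDne : D.Nonempty := ⟨((c + 1 : ℝ) : ℂ), by simp [hD, -ofReal_add]⟩
  set Q : ℂ → ℂ := fun s => L s * exp (s * b) / a with hQ
  have ha' : (a : ℂ) ≠ 0 := ofReal_ne_zero.2 ha.ne'
  have hQc : ContinuousOn Q D :=
    (hLc.mul (Continuous.continuousOn (by fun_prop))).div_const _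
  have hQ0 : ∀ s ∈ D, Q s ≠ 0 := fun s hs =>
    div_ne_zero (mul_ne_zero (hL0 s hs) (exp_ne_zero _)) ha'
  obtain ⟨h, hhc, hh⟩ := exists_continuousOn_eqOn_exp_comp
    (isSimplyConnected_of_convex hDc hDne) hDo hQc (by rintro ⟨s, hs, e⟩; exact hQ0 s hs e)
  have hh' : ∀ s ∈ D, Q s = ‖Q s‖ * exp ((h s).im * I) := by
    intro s hs
    have : exp (h s) = Q s := hh hs
    rw [← this, norm_exp, ofReal_exp, ← exp_add, re_add_im]
  obtain ⟨σ₁, hσ₁⟩ := hlim 1 one_pos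
  set σ₂ := max c σ₁
  set E : Set ℂ := {s | σ₂ < s.re}
  have hED : E ⊆ D := fun s hs => lt_of_le_of_lt (le_max_left c σ₁) hs
  have hE1 : ∀ s ∈ E, ‖Q s - 1‖ < 1 := fun s hs => hσ₁ s (lt_of_le_of_lt (le_max_right c σ₁) hs)
  have hslit : ∀ s ∈ E, Q s ∈ slitPlane := fun s hs => by
    have := mem_slitPlane_of_norm_lt_one (hE1 s hs)
    simpa using this
  set s₁ : ℂ := ((σ₂ + 1 : ℝ) : ℂ) with hs₁
  have hs₁E : s₁ ∈ E := by
    change σ₂ < s₁.re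
    rw [hs₁, ofReal_re]; linarith
  -- The imaginary part of the logarithm h is determined only up to 2πℤ. Comparing with the
  -- principal argument far to the right, where Q is close to 1, fixes the multiple to be
  -- subtracted.
  set κ := (h s₁).im - arg (Q s₁) with hκ
  have hconst : ∀ s ∈ E, (h s).im - arg (Q s) = κ := fun s hs =>
    arg_sub_eq (convex_halfSpace_re_gt σ₂).isPreconnected (fun s hs => hQ0 s (hED hs))
      (A := fun s => (h s).im) (B := fun s => arg (Q s))
      (continuous_im.comp_continuousOn (hhc.mono hED))
      (fun s hs => ((continuousAt_arg (hslit s hs)).comp_continuousWithinAt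
        ((hQc.mono hED) s hs)))
      (fun s hs => hh' s (hED hs)) (fun s _ => (norm_mul_exp_arg_mul_I _).symm) hs hs₁E
  have hκexp : exp (-κ * I) = 1 := by
    obtain ⟨n, hn⟩ := exists_int_of_arg (hQ0 s₁ (hED hs₁E)) (hh' s₁ (hED hs₁E))
      (norm_mul_exp_arg_mul_I _).symm
    have hpi := Real.pi_ne_zero
    have hn' : κ = n * (2 * Real.pi) := by
      rw [hκ]; field_simp at hn; linarith
    rw [hn']
    push_cast
    rw [show -((n : ℂ) * (2 * Real.pi)) * I = ((-n : ℤ) : ℂ) * (2 * Real.pi * I) by push_cast; ring]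
    exact exp_int_mul_two_pi_mul_I _
  refine ⟨fun s => (h s).im - κ - s.im * b, ?_, fun s hs => ?_, fun t => ?_⟩
  · exact ((continuous_im.comp_continuousOn hhc).sub continuousOn_const).sub
      (Continuous.continuousOn (by fun_prop))
  · have h1 : L s = Q s * (a * exp (-(s * b))) := by
      simp only [hQ]
      rw [exp_neg]
      field_simp [exp_ne_zero]
    have h2 : (a * exp (-(s * b)) : ℂ) = ‖(a * exp (-(s * b)) : ℂ)‖ *
        exp ((-(s.im * b) : ℝ) * I) := by
      rw [norm_mul, norm_exp, norm_real, Real.norm_of_nonneg ha.le]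
      rw [ofReal_mul, ofReal_exp, mul_assoc, ← exp_add]
      congr 2
      conv_lhs => rw [← re_add_im s]
      simp only [neg_re, mul_re, ofReal_re, ofReal_im, mul_zero, sub_zero]
      push_cast
      ring
    have h3 := eq_norm_mul_exp_arg_add (hh' s hs) h2
    rw [← h1] at h3
    rw [h3]
    simp only [norm_mul, norm_real, norm_norm, norm_exp_ofReal_mul_I, mul_one]
    rw [show (((h s).im - κ - s.im * b : ℝ) : ℂ) * I =
      (((h s).im + -(s.im * b) : ℝ) : ℂ) * I + -κ * I by push_cast; ring, exp_add, hκexp, mul_one]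
  · have hQlim : Tendsto (fun σ : ℝ => Q (σ + t * I)) atTop (𝓝 1) := by
      rw [Metric.tendsto_atTop]
      intro ε hε
      obtain ⟨σ₀, h0⟩ := hlim ε hε
      refine ⟨σ₀ + 1, fun σ hσ => ?_⟩
      rw [dist_eq_norm]
      exact h0 _ (by simp; linarith)
    have harg : Tendsto (fun σ : ℝ => arg (Q (σ + t * I))) atTop (𝓝 0) := by
      rw [← arg_one]
      exact (continuousAt_arg one_mem_slitPlane).tendsto.comp hQlim
    have h4 := harg.sub_const (t * b)
    rw [zero_sub] at h4
    refine h4.congr' ?_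
    filter_upwards [eventually_gt_atTop σ₂] with σ hσ
    have := hconst (σ + t * I) (by change σ₂ < _; simpa using hσ)
    simp
    linarith

/-! ### Right of the critical line: the pole and the leading Dirichlet term. -/

section

variable {k : ℤ} (hk : 4 ≤ k) (f : ModularForm 𝒮ℒ k)

/-- A form for which `arg L_f` is defined along the real ray is cuspidal. -/
theorem HasArgLimit.qCoeff_zero {ℓ : ℝ} (h : HasArgLimit hk f 0 ℓ) : qCoeff f 0 = 0 := by
  by_contra hne
  obtain ⟨φ, hc, hφ, -, -⟩ := h
  have hkpos := half_pos_real hk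
  have hkk : (k : ℝ) / 2 < k := by linarith
  have hre : 0 < ((k : ℝ) : ℂ).re := by rw [ofReal_re]; linarith
  have hres := (fePair hk f).Λ_residue_k
  have hk' : (((fePair hk f).k : ℝ) : ℂ) = ((k : ℝ) : ℂ) := rfl
  rw [hk', fePair_g₀, fePair_f₀] at hres
  have hG : Tendsto (fun s => 2 / Gammaℂ s) (𝓝[≠] ((k : ℝ) : ℂ)) (𝓝 (2 / Gammaℂ ((k : ℝ) : ℂ))) := by
    simp_rw [div_eq_mul_inv]
    exact ((differentiable_Gammaℂ_inv.continuous.tendsto _).const_mul 2).mono_left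
      nhdsWithin_le_nhds
  have hprod := hres.mul hG
  set r := (fePair hk f).ε • qCoeff f 0 * (2 / Gammaℂ ((k : ℝ) : ℂ)) with hr
  have hr0 : r ≠ 0 := mul_ne_zero (mul_ne_zero (fePair hk f).hε hne)
    (div_ne_zero two_ne_zero (gammaℂ_ne_zero hre))
  have hof : Tendsto (fun σ : ℝ => (σ : ℂ)) (𝓝[≠] (k : ℝ)) (𝓝[≠] ((k : ℝ) : ℂ)) := by
    refine tendsto_nhdsWithin_iff.2 ⟨(continuous_ofReal.tendsto _).mono_left nhdsWithin_le_nhds, ?_⟩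
    filter_upwards [self_mem_nhdsWithin] with σ hσ
    exact fun he => hσ (ofReal_injective he)
  have hL : Tendsto (fun σ : ℝ => ((σ : ℂ) - (k : ℝ)) * LFun hk f σ) (𝓝[≠] (k : ℝ)) (𝓝 r) := by
    refine (hprod.comp hof).congr fun σ => ?_
    simp only [Function.comp_apply, smul_eq_mul]
    rw [mul_assoc]
    rfl
  have hφc : Tendsto (fun σ : ℝ => exp (φ σ * I)) (𝓝[≠] (k : ℝ)) (𝓝 (exp (φ k * I))) := by
    have h1 : ContinuousAt φ (k : ℝ) := hc.continuousAt (Ioi_mem_nhds hkk)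
    have : Continuous fun x : ℝ => exp ((x : ℂ) * I) := by fun_prop
    exact ((this.tendsto _).comp h1.tendsto).mono_left nhdsWithin_le_nhds
  have hN := ((continuous_ofReal.tendsto _).comp hL.norm).mul hφc
  have hφ' : ∀ᶠ σ : ℝ in 𝓝 (k : ℝ), LFun hk f σ = ‖LFun hk f σ‖ * exp (φ σ * I) := by
    filter_upwards [Ioi_mem_nhds hkk] with σ hσ
    simpa using (hφ σ hσ).2
  have hgt : 𝓝[>] (k : ℝ) ≤ 𝓝[≠] (k : ℝ) := nhdsWithin_mono _ fun x hx => ne_of_gt hx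
  have hlt : 𝓝[<] (k : ℝ) ≤ 𝓝[≠] (k : ℝ) := nhdsWithin_mono _ fun x hx => ne_of_lt hx
  -- Close to k, (σ - k)L(σ) tends to r ≠ 0 while the phase of L is continuous. From the right r has
  -- this phase, from the left -r does.
  have hright : r = ‖r‖ * exp (φ k * I) := by
    refine tendsto_nhds_unique (hL.mono_left hgt)
      ((hN.mono_left hgt).congr' ?_)
    filter_upwards [self_mem_nhdsWithin, nhdsWithin_le_nhds hφ'] with σ hσ h1
    have hσ' : (0 : ℝ) < σ - k := sub_pos.2 hσ
    simp only [Function.comp_apply]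
    rw [norm_mul, ← ofReal_sub, norm_real, Real.norm_of_nonneg hσ'.le, ofReal_mul, mul_assoc, ← h1]
  have hleft : -r = ‖r‖ * exp (φ k * I) := by
    refine tendsto_nhds_unique
      (hL.neg.mono_left hlt)
      ((hN.mono_left hlt).congr' ?_)
    filter_upwards [self_mem_nhdsWithin, nhdsWithin_le_nhds hφ'] with σ hσ h1
    have hσ' : σ - (k : ℝ) < 0 := sub_neg.2 hσ
    simp only [Function.comp_apply]
    rw [norm_mul, ← ofReal_sub, norm_real, Real.norm_of_nonpos hσ'.le, ofReal_mul, mul_assoc, ← h1]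
    push_cast
    ring
  exact hr0 (self_eq_neg.1 (hright.trans hleft.symm))

theorem hasSum_lFun {s : ℂ} (hs : k + 1 < s.re) :
    HasSum (fun n : ℕ => qCoeff f n / (n : ℂ) ^ s) (LFun hk f s) := by
  have h := ModularForm.hasSum_L (lt_of_lt_of_le four_pos hk) f hs
  rw [Subgroup.strictWidthInfty_SL2Z] at h
  simpa using! h

end

section

variable {k : ℤ} (hk : 4 ≤ k) (f : ModularForm 𝒮ℒ k)

theorem leadIndex_spec {t ℓ : ℝ} (h : HasArgLimit hk f t ℓ) :
    1 ≤ leadIndex f ∧ ∀ n, 1 ≤ n → n < leadIndex f → qCoeff f n = 0 := by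
  -- On the empty set `leadIndex` would default to 0. This is excluded because L would then vanish
  -- in the region of absolute convergence, against its non-vanishing on the ray.
  have hne : {n : ℕ | 1 ≤ n ∧ qCoeff f n ≠ 0}.Nonempty := by
    by_contra hemp
    rw [Set.not_nonempty_iff_eq_empty, Set.eq_empty_iff_forall_notMem] at hemp
    obtain ⟨φ, -, hφ, -, -⟩ := h
    have hk4 : (4 : ℝ) ≤ k := by exact_mod_cast hk
    refine (hφ (k + 2) (by linarith)).1 ((hasSum_lFun hk f (s := ((k + 2 : ℝ) : ℂ) + t * I)
      (by simp)).unique ?_)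
    refine hasSum_zero.congr_fun fun n => ?_
    rcases n.eq_zero_or_pos with rfl | hn
    · rw [Nat.cast_zero, zero_cpow, div_zero]
      intro he
      have := congrArg re he
      simp at this
      linarith
    · have : qCoeff f n = 0 := by
        by_contra hc
        exact hemp n ⟨hn, hc⟩
      rw [this, zero_div]
  refine ⟨(Nat.sInf_mem hne).1, fun n hn hlt => ?_⟩
  by_contra hc
  exact absurd (Nat.sInf_le (show n ∈ {n : ℕ | 1 ≤ n ∧ qCoeff f n ≠ 0} from ⟨hn, hc⟩))
    (not_le.2 hlt)

/-- Beyond its leading term a Dirichlet series decays geometrically in `Re s`. -/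
theorem norm_lFun_mul_sub_le {m : ℕ} (hm : 1 ≤ m) (hz : ∀ n, 1 ≤ n → n < m → qCoeff f n = 0) :
    ∃ C : ℝ, ∀ s : ℂ, k + 2 ≤ s.re →
      ‖LFun hk f s * (m : ℂ) ^ s - qCoeff f m‖ ≤ C * ((m : ℝ) / (m + 1)) ^ (s.re - (k + 2)) := by
  have hk4 : (4 : ℝ) ≤ k := by exact_mod_cast hk
  have hm0 : (0 : ℝ) < m := by exact_mod_cast hm
  have hsum : Summable fun n : ℕ => ‖qCoeff f n / (n : ℂ) ^ ((k + 2 : ℝ) : ℂ)‖ * (m : ℝ) ^ (k + 2 : ℝ) :=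
    ((hasSum_lFun hk f (s := ((k + 2 : ℝ) : ℂ)) (by simp)).summable.norm).mul_right _
  refine ⟨∑' n : ℕ, ‖qCoeff f n / (n : ℂ) ^ ((k + 2 : ℝ) : ℂ)‖ * (m : ℝ) ^ (k + 2 : ℝ),
    fun s hs => ?_⟩
  have h1 := (hasSum_lFun hk f (s := s) (by linarith)).mul_right ((m : ℂ) ^ s)
  have h2 := hasSum_ite_sub_hasSum h1 m
  have hms : (m : ℂ) ^ s ≠ 0 := by
    rw [Ne, cpow_eq_zero_iff]
    rintro ⟨h, -⟩
    exact hm0.ne' (by exact_mod_cast h)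
  rw [div_mul_cancel₀ _ hms] at h2
  rw [← h2.tsum_eq]
  refine tsum_of_norm_bounded (hsum.hasSum.mul_right _) fun n => ?_
  have hnn : 0 ≤ ‖qCoeff f n / (n : ℂ) ^ ((k + 2 : ℝ) : ℂ)‖ * (m : ℝ) ^ (k + 2 : ℝ) *
    ((m : ℝ) / (m + 1)) ^ (s.re - (k + 2)) := by positivity
  split_ifs with hnm
  · simpa using hnn
  · rcases n.eq_zero_or_pos with rfl | hn
    · rw [Nat.cast_zero, zero_cpow, div_zero, zero_mul, norm_zero]
      · simpa using hnn
      · intro he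
        have := congrArg re he
        simp at this
        linarith
    · rcases lt_or_ge n m with hlt | hge
      · rw [hz n hn hlt, zero_div, zero_mul, norm_zero]
        positivity
      · have hgt : m + 1 ≤ n := by omega
        have hn0 : (0 : ℝ) < n := by exact_mod_cast hn
        have hgt' : (m : ℝ) + 1 ≤ n := by exact_mod_cast hgt
        rw [norm_mul, norm_div, norm_div, norm_natCast_cpow_of_pos hn,
          norm_natCast_cpow_of_pos hn, norm_natCast_cpow_of_pos hm, ofReal_re]
        set x := s.re
        -- The term at real part k + 2 is split off; the remaining factor is at most (m/(m + 1)) to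
        -- the same power because n ≥ m + 1.
        have e1 : ‖qCoeff f n‖ / (n : ℝ) ^ x * (m : ℝ) ^ x =
            ‖qCoeff f n‖ / (n : ℝ) ^ (k + 2 : ℝ) * (m : ℝ) ^ (k + 2 : ℝ) *
              ((m : ℝ) / n) ^ (x - (k + 2)) := by
          rw [Real.div_rpow hm0.le hn0.le, Real.rpow_sub hm0, Real.rpow_sub hn0]
          have a1 := (Real.rpow_pos_of_pos hn0 x).ne'
          have a2 := (Real.rpow_pos_of_pos hn0 (k + 2 : ℝ)).ne'
          have a3 := (Real.rpow_pos_of_pos hm0 (k + 2 : ℝ)).ne'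
          field_simp
        rw [e1]
        gcongr

theorem exists_forall_norm_lFun_sub_lt {m : ℕ} (hm : 1 ≤ m)
    (hz : ∀ n, 1 ≤ n → n < m → qCoeff f n = 0) {ε : ℝ} (hε : 0 < ε) :
    ∃ σ₀ : ℝ, ∀ s : ℂ, σ₀ < s.re → ‖LFun hk f s * (m : ℂ) ^ s - qCoeff f m‖ < ε := by
  obtain ⟨C, hC⟩ := norm_lFun_mul_sub_le hk f hm hz
  have hm0 : (0 : ℝ) < m := by exact_mod_cast hm
  have hlim : Tendsto (fun x : ℝ => C * ((m : ℝ) / (m + 1)) ^ (x - (k + 2))) atTop (𝓝 0) := by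
    have h1 : Tendsto (fun x : ℝ => ((m : ℝ) / (m + 1)) ^ x) atTop (𝓝 0) :=
      tendsto_rpow_atTop_of_base_lt_one _ (by linarith [div_pos hm0 (by linarith : (0:ℝ) < m + 1)])
        ((div_lt_one (by linarith)).2 (by linarith))
    have h2 := (h1.comp (tendsto_atTop_add_const_right atTop (-(k + 2 : ℝ)) tendsto_id)).const_mul C
    rw [mul_zero] at h2
    exact h2.congr fun x => by simp [sub_eq_add_neg]
  obtain ⟨σ₁, h1⟩ := eventually_atTop.1 (hlim.eventually_lt_const hε)
  refine ⟨max σ₁ (k + 2), fun s hs => (hC s ?_).trans_lt (h1 _ ?_)⟩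
  · exact ((le_max_right _ _).trans_lt hs).le
  · exact ((le_max_left _ _).trans_lt hs).le

variable (hreal : ∀ n : ℕ, (qCoeff f n).im = 0) (hpos : 0 < (qCoeff f (leadIndex f)).re)

include hreal hpos in
/-- A continuous argument of `L_f` in the half-plane of non-vanishing, compatible with `S`. -/
theorem exists_arg_lFun {S : ℝ → ℝ} (hS : ∀ t : ℝ, HasArgLimit hk f t (S t)) :
    ∃ A : ℂ → ℝ, ContinuousOn A {s | (k : ℝ) / 2 < s.re} ∧
      (∀ s : ℂ, (k : ℝ) / 2 < s.re → LFun hk f s = ‖LFun hk f s‖ * exp (A s * I)) ∧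
      ∀ t : ℝ, Tendsto (fun σ : ℝ => A (σ + t * I)) (𝓝[>] ((k : ℝ) / 2)) (𝓝 (S t)) := by
  have hcusp := (hS 0).qCoeff_zero hk f
  have hkp := half_pos_real hk
  obtain ⟨hm, hz⟩ := leadIndex_spec hk f (hS 0)
  set m := leadIndex f
  set a := (qCoeff f m).re with ha
  have ham : qCoeff f m = a := by
    apply Complex.ext <;> simp [ha, hreal m]
  have hm0 : (0 : ℝ) < m := by exact_mod_cast hm
  have hne : ∀ s : ℂ, (k : ℝ) / 2 < s.re → LFun hk f s ≠ 0 := by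
    intro s hs
    obtain ⟨φ, -, hφ, -⟩ := hS s.im
    have := (hφ s.re hs).1
    rwa [re_add_im] at this
  have hcont : ContinuousOn (LFun hk f) {s | (k : ℝ) / 2 < s.re} := fun s hs => by
    refine (differentiableAt_lFun hk f ?_ (.inr hcusp)).continuousAt.continuousWithinAt
    rintro rfl
    have : (k : ℝ) / 2 < 0 := by simpa using hs
    linarith
  obtain ⟨A, hAc, hA, hAlim⟩ := exists_continuous_arg hcont hne hpos (b := Real.log m)
    (fun ε hε => by
      obtain ⟨σ₀, h0⟩ := exists_forall_norm_lFun_sub_lt hk f hm hz (mul_pos hpos hε)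
      refine ⟨σ₀, fun s hs => ?_⟩
      have h1 := h0 s hs
      have hexp : (m : ℂ) ^ s = exp (s * Real.log m) := by
        rw [cpow_def_of_ne_zero (by exact_mod_cast hm0.ne'), mul_comm, natCast_log]
      have ha0 : (a : ℂ) ≠ 0 := ofReal_ne_zero.2 hpos.ne'
      have e : LFun hk f s * exp (s * Real.log m) / a - 1 =
          (LFun hk f s * (m : ℂ) ^ s - qCoeff f m) / a := by
        rw [hexp, ham]; field_simp
      change ‖LFun hk f s * exp (s * Real.log m) / a - 1‖ < ε
      rw [e, norm_div, norm_real, Real.norm_of_nonneg hpos.le, div_lt_iff₀ hpos, mul_comm ε]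
      exact h1)
  refine ⟨A, hAc, hA, fun t => ?_⟩
  obtain ⟨φ, hφc, hφ, hφtop, hφlim⟩ := hS t
  have hline : ∀ σ : ℝ, ((σ : ℂ) + t * I).re = σ := fun σ => by simp
  have hAline : ContinuousOn (fun σ : ℝ => A (σ + t * I)) (Set.Ioi ((k : ℝ) / 2)) :=
    hAc.comp (Continuous.continuousOn (by fun_prop)) fun σ hσ => by
      change (k : ℝ) / 2 < _
      rw [hline]; exact hσ
  -- The given φ and the global A are both continuous arguments on the ray, so they differ by a
  -- constant; both tend to -t log m at +∞, so the constant is 0.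
  have hsub : ∀ σ ∈ Set.Ioi ((k : ℝ) / 2), ∀ σ' ∈ Set.Ioi ((k : ℝ) / 2),
      φ σ - A (σ + t * I) = φ σ' - A (σ' + t * I) := fun σ hσ σ' hσ' =>
    arg_sub_eq (L := fun σ : ℝ => LFun hk f (σ + t * I)) (A := φ)
      (B := fun σ : ℝ => A (σ + t * I)) isPreconnected_Ioi
      (fun σ hσ => (hφ σ hσ).1) hφc hAline (fun σ hσ => (hφ σ hσ).2)
      (fun σ hσ => hA _ (by rw [hline]; exact hσ)) hσ hσ'
  have heq : ∀ σ ∈ Set.Ioi ((k : ℝ) / 2), φ σ = A (σ + t * I) := by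
    intro σ hσ
    have h1 := hφtop.sub (hAlim t)
    rw [sub_self] at h1
    have h2 : Tendsto (fun σ' : ℝ => φ σ' - A (σ' + t * I)) atTop (𝓝 (φ σ - A (σ + t * I))) := by
      refine tendsto_const_nhds.congr' ?_
      filter_upwards [eventually_gt_atTop ((k : ℝ) / 2)] with σ' hσ'
      exact hsub σ hσ σ' hσ'
    exact sub_eq_zero.1 (tendsto_nhds_unique h2 h1)
  refine hφlim.congr' ?_
  filter_upwards [self_mem_nhdsWithin] with σ hσ
  exact heq σ hσ

/-- `m` is the order of vanishing of `L_f` at `k/2 + i t`. -/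
def IsZeroOrder (t : ℝ) (m : ℕ) : Prop :=
  ∃ u : ℂ → ℂ, AnalyticAt ℂ u (critPt k t) ∧ u (critPt k t) ≠ 0 ∧
    ∀ᶠ s in 𝓝 (critPt k t), LFun hk f s = (s - critPt k t) ^ m * u s

theorem analyticAt_lFun_critPt (t : ℝ) : AnalyticAt ℂ (LFun hk f) (critPt k t) := by
  refine analyticAt_iff_eventually_differentiableAt.2 ?_
  filter_upwards [isOpen_ne.mem_nhds (critPt_ne_zero hk t), isOpen_ne.mem_nhds (critPt_ne hk t)]
    with s h0 h1
  exact differentiableAt_lFun hk f h0 (.inl h1)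

theorem exists_isZeroOrder {t ℓ : ℝ} (h : HasArgLimit hk f t ℓ) : ∃ m, IsZeroOrder hk f t m := by
  have hne : ¬ ∀ᶠ s in 𝓝 (critPt k t), LFun hk f s = 0 := by
    intro hev
    obtain ⟨φ, -, hφ, -⟩ := h
    have h1 := (ray_tendsto k t).eventually hev
    obtain ⟨σ, h2, h3⟩ := (h1.and self_mem_nhdsWithin).exists
    exact (hφ σ h3).1 h2
  obtain ⟨m, u, hu, hu0, h⟩ :=
    (analyticAt_lFun_critPt hk f t).exists_eventuallyEq_pow_smul_nonzero_iff.2 hne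
  exact ⟨m, u, hu, hu0, h⟩

variable {hk f} in
theorem IsZeroOrder.eq_zero_iff {t : ℝ} {m : ℕ} (h : IsZeroOrder hk f t m) :
    m = 0 ↔ LFun hk f (critPt k t) ≠ 0 := by
  obtain ⟨u, -, hu0, h⟩ := h
  rw [h.self_of_nhds, sub_self]
  rcases Nat.eq_zero_or_pos m with rfl | hm
  · simp [hu0]
  · simp [hm.ne']

variable {hk f} in
theorem IsZeroOrder.eq_one_iff {t : ℝ} {m : ℕ} (h : IsZeroOrder hk f t m) :
    m = 1 ↔ IsSimpleZero hk f t := by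
  have h0 := h.eq_zero_iff
  obtain ⟨u, hu, hu0, he⟩ := h
  have hd : HasDerivAt (LFun hk f) (m * (critPt k t - critPt k t) ^ (m - 1) * 1 * u (critPt k t) +
      (critPt k t - critPt k t) ^ m * deriv u (critPt k t)) (critPt k t) :=
    ((((hasDerivAt_id' _).sub_const (critPt k t)).fun_pow m).fun_mul
      hu.differentiableAt.hasDerivAt).congr_of_eventuallyEq he
  have hd' := hd.deriv
  rw [IsSimpleZero]
  rcases m with _ | _ | m
  · have := h0.1 rfl
    simp [this]
  · simp only [zero_add, true_iff] at *
    refine ⟨by simpa using h0, ?_⟩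
    rw [hd']
    simpa using hu0
  · rw [hd']
    simp

end

/-! ### Jumps of S and the step function. -/

section

variable {k : ℤ} (hk : 4 ≤ k) (f : ModularForm 𝒮ℒ k)

/-- Near an ordinate `t`, the limit argument `S` is a continuous function plus a jump. -/
theorem exists_local_jump {S : ℝ → ℝ} {A : ℂ → ℝ}
    (hne : ∀ s : ℂ, (k : ℝ) / 2 < s.re → LFun hk f s ≠ 0)
    (hAc : ContinuousOn A {s | (k : ℝ) / 2 < s.re})
    (hA : ∀ s : ℂ, (k : ℝ) / 2 < s.re → LFun hk f s = ‖LFun hk f s‖ * exp (A s * I))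
    (hS : ∀ t : ℝ, Tendsto (fun σ : ℝ => A (σ + t * I)) (𝓝[>] ((k : ℝ) / 2)) (𝓝 (S t)))
    {t : ℝ} {m : ℕ} (hm : IsZeroOrder hk f t m) :
    ∃ r > 0, ∃ g : ℝ → ℝ, ContinuousOn g (Set.Ioo (t - r) (t + r)) ∧ S t = g t ∧
      (∀ u, t < u → u < t + r → LFun hk f (critPt k u) ≠ 0 ∧ S u = g u + m * (Real.pi / 2)) ∧
      (∀ u, t - r < u → u < t → LFun hk f (critPt k u) ≠ 0 ∧ S u = g u - m * (Real.pi / 2)) := by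
  obtain ⟨u, hu, hu0, he⟩ := hm
  set s₀ := critPt k t with hs₀
  have hnear : ∀ᶠ s in 𝓝 s₀, ‖u s / u s₀ - 1‖ < 1 := by
    have h1 : Tendsto (fun s => ‖u s / u s₀ - 1‖) (𝓝 s₀) (𝓝 0) := by
      have := ((hu.continuousAt.tendsto.div_const (u s₀)).sub_const 1).norm
      simpa [hu0] using this
    exact h1.eventually_lt_const one_pos
  obtain ⟨r, hr, hball⟩ := Metric.eventually_nhds_iff_ball.1
    (he.and (hnear.and hu.eventually_analyticAt))
  set b : ℂ → ℝ := fun s => arg (u s₀) + arg (u s / u s₀) with hb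
  have hslit : ∀ s ∈ Metric.ball s₀ r, u s / u s₀ ∈ slitPlane := fun s hs => by
    have := mem_slitPlane_of_norm_lt_one (hball s hs).2.1
    simpa using this
  have hune : ∀ s ∈ Metric.ball s₀ r, u s ≠ 0 := fun s hs h0 => by
    have := slitPlane_ne_zero (hslit s hs)
    rw [h0, zero_div] at this
    exact this rfl
  have hbc : ∀ s ∈ Metric.ball s₀ r, ContinuousAt b s := fun s hs =>
    continuousAt_const.add (ContinuousAt.comp (f := fun s => u s / u s₀)
      (continuousAt_arg (hslit s hs)) ((hball s hs).2.2.continuousAt.div_const _))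
  have hub : ∀ s ∈ Metric.ball s₀ r, u s = ‖u s‖ * exp (b s * I) := fun s _ => by
    have := eq_norm_mul_exp_arg_add (norm_mul_exp_arg_mul_I (u s₀)).symm
      (norm_mul_exp_arg_mul_I (u s / u s₀)).symm
    rwa [mul_div_cancel₀ _ hu0] at this
  set V : Set ℂ := Metric.ball s₀ r ∩ {s | (k : ℝ) / 2 < s.re} with hV
  have hVc : IsPreconnected V :=
    ((convex_ball s₀ r).inter (convex_halfSpace_re_gt _)).isPreconnected
  have hVslit : ∀ s ∈ V, s - s₀ ∈ slitPlane := fun s hs => by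
    refine Or.inl ?_
    have : (k : ℝ) / 2 < s.re := hs.2
    rw [sub_re, hs₀, critPt_re]
    linarith
  set s₁ : ℂ := s₀ + ((r / 2 : ℝ) : ℂ) with hs₁
  have hs₁V : s₁ ∈ V := by
    refine ⟨?_, ?_⟩
    · rw [Metric.mem_ball, dist_eq_norm, hs₁, add_sub_cancel_left, norm_real,
        Real.norm_of_nonneg (by positivity)]
      linarith
    · change (k : ℝ) / 2 < s₁.re
      rw [hs₁, add_re, hs₀, critPt_re, ofReal_re]
      linarith
  -- In the right half of the disc s - s₀ has positive real part, so its principal argument is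
  -- continuous and A' is an argument of L there, differing from A by the constant κ.
  set A' : ℂ → ℝ := fun s => m * arg (s - s₀) + b s with hA'
  set κ := A s₁ - A' s₁ with hκ
  have hconst : ∀ s ∈ V, A s - A' s = κ := fun s hs => by
    refine arg_sub_eq hVc (L := LFun hk f) (fun s hs => hne s hs.2) (A := A) (B := A')
      (hAc.mono Set.inter_subset_right) (fun s hs => ?_) (fun s hs => hA s hs.2)
      (fun s hs => ?_) hs hs₁V
    · refine ContinuousAt.continuousWithinAt ?_
      have h1 : ContinuousAt (fun s => arg (s - s₀)) s :=
        ContinuousAt.comp (f := fun s => s - s₀) (continuousAt_arg (hVslit s hs)) (by fun_prop)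
      exact (continuousAt_const.mul h1).add (hbc s hs.1)
    · rw [(hball s hs.1).1]
      exact eq_norm_mul_exp_arg_add
        (pow_eq_norm_mul_exp (norm_mul_exp_arg_mul_I (s - s₀)).symm m) (hub s hs.1)
  have hmem : ∀ v : ℝ, |v - t| < r → critPt k v ∈ Metric.ball s₀ r := fun v hv => by
    rw [Metric.mem_ball, dist_eq_norm, hs₀, critPt_eq, critPt_eq, add_sub_add_left_eq_sub,
      ← sub_mul, norm_mul, norm_I, mul_one, ← ofReal_sub, norm_real]
    exact hv
  have hdiff : ∀ v : ℝ, critPt k v - s₀ = ((v - t : ℝ) : ℂ) * I := fun v => by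
    rw [hs₀, critPt_eq, critPt_eq]; push_cast; ring
  -- Only the boundary value θ of arg(s - s₀) is discontinuous in v: it is -π/2 below t, 0 at t and
  -- π/2 above.
  have hlim : ∀ v : ℝ, |v - t| < r → ∀ θ : ℝ,
      Tendsto (fun σ : ℝ => arg (σ + v * I - s₀)) (𝓝[>] ((k : ℝ) / 2)) (𝓝 θ) →
      S v = b (critPt k v) + κ + m * θ := by
    intro v hv θ hθ
    have h1 := (((hθ.const_mul (m : ℝ)).add
      ((hbc _ (hmem v hv)).tendsto.comp (ray_tendsto k v))).add_const κ)
    have h2 : S v = m * θ + b (critPt k v) + κ := by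
      refine tendsto_nhds_unique (hS v) (h1.congr' ?_)
      filter_upwards [self_mem_nhdsWithin,
        (ray_tendsto k v).eventually (Metric.isOpen_ball.mem_nhds (hmem v hv))] with σ hσ hσb
      have hσV : (σ : ℂ) + v * I ∈ V := ⟨hσb, by
        change (k : ℝ) / 2 < _
        simpa using hσ⟩
      have := hconst _ hσV
      simp only [hA', Function.comp_apply] at this ⊢
      linarith
    linarith
  have hoff : ∀ v : ℝ, v ≠ t → Tendsto (fun σ : ℝ => arg (σ + v * I - s₀)) (𝓝[>] ((k : ℝ) / 2))
      (𝓝 (arg (((v - t : ℝ) : ℂ) * I))) := fun v hv => by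
    have hsl : critPt k v - s₀ ∈ slitPlane := Or.inr (by
      rw [hdiff]
      simpa [sub_eq_zero] using hv)
    have h1 := (continuousAt_arg hsl).tendsto.comp ((ray_tendsto k v).sub_const s₀)
    rwa [hdiff] at h1
  have hLne : ∀ v : ℝ, |v - t| < r → v ≠ t → LFun hk f (critPt k v) ≠ 0 := fun v hv hvt => by
    rw [(hball _ (hmem v hv)).1]
    refine mul_ne_zero (pow_ne_zero _ ?_) (hune _ (hmem v hv))
    rw [hdiff]
    exact mul_ne_zero (ofReal_ne_zero.2 (sub_ne_zero.2 hvt)) I_ne_zero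
  refine ⟨r, hr, fun v => b (critPt k v) + κ, ?_, ?_, ?_, ?_⟩
  · intro v hv
    refine ContinuousAt.continuousWithinAt ?_
    have hv' : |v - t| < r := abs_lt.2 ⟨by linarith [hv.1], by linarith [hv.2]⟩
    have hc : ContinuousAt (critPt k) v := (hasDerivAt_critPt v).continuousAt
    exact (ContinuousAt.comp (f := critPt k) (hbc _ (hmem v hv')) hc).add continuousAt_const
  · have := hlim t (by simpa using hr) 0 (by
      refine tendsto_const_nhds.congr' ?_
      filter_upwards [self_mem_nhdsWithin] with σ hσ
      have hσ' : (0 : ℝ) ≤ σ - (k : ℝ) / 2 := (sub_pos.2 hσ).le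
      have e : (σ : ℂ) + t * I - s₀ = ((σ - (k : ℝ) / 2 : ℝ) : ℂ) := by
        rw [hs₀, critPt_eq]; push_cast; ring
      rw [e, arg_ofReal_of_nonneg hσ'])
    rw [this, mul_zero, add_zero]
  · intro v h1 h2
    have hv : |v - t| < r := abs_lt.2 ⟨by linarith, by linarith⟩
    refine ⟨hLne v hv h1.ne', hlim v hv _ ?_⟩
    have := hoff v h1.ne'
    rwa [arg_real_mul _ (sub_pos.2 h1), arg_I] at this
  · intro v h1 h2
    have hv : |v - t| < r := abs_lt.2 ⟨by linarith, by linarith⟩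
    refine ⟨hLne v hv h2.ne, ?_⟩
    have h3 := hlim v hv (-(Real.pi / 2)) (by
      have := hoff v h2.ne
      rwa [show ((v - t : ℝ) : ℂ) * I = ((t - v : ℝ) : ℂ) * -I by push_cast; ring,
        arg_real_mul _ (sub_pos.2 h2), arg_neg_I] at this)
    rw [h3]; ring

theorem eq_of_continuousOn_Ico {g : ℝ → ℝ} {a b α : ℝ} (hg : ContinuousOn g (Set.Ico a b))
    (hint : ∀ x ∈ Set.Ioo a b, ∃ n : ℤ, g x = n + α) {x : ℝ} (hx : x ∈ Set.Ioo a b) :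
    g x = g a := by
  have hc : Tendsto g (𝓝[Set.Ioo a b] a) (𝓝 (g a)) :=
    (hg a ⟨le_rfl, hx.1.trans hx.2⟩).mono Set.Ioo_subset_Ico_self
  have hne : (𝓝[Set.Ioo a b] a).NeBot := left_nhdsWithin_Ioo_neBot (hx.1.trans hx.2)
  refine tendsto_nhds_unique (tendsto_const_nhds.congr' ?_) hc
  filter_upwards [self_mem_nhdsWithin] with y hy
  exact eq_of_continuousOn_of_int isPreconnected_Ioo (hg.mono Set.Ioo_subset_Ico_self) hint hx hy

theorem eq_of_continuousOn_Ioc {g : ℝ → ℝ} {a b α : ℝ} (hg : ContinuousOn g (Set.Ioc a b))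
    (hint : ∀ x ∈ Set.Ioo a b, ∃ n : ℤ, g x = n + α) {x : ℝ} (hx : x ∈ Set.Ioo a b) :
    g x = g b := by
  have hc : Tendsto g (𝓝[Set.Ioo a b] b) (𝓝 (g b)) :=
    (hg b ⟨hx.1.trans hx.2, le_rfl⟩).mono Set.Ioo_subset_Ioc_self
  have hne : (𝓝[Set.Ioo a b] b).NeBot := right_nhdsWithin_Ioo_neBot (hx.1.trans hx.2)
  refine tendsto_nhds_unique (tendsto_const_nhds.congr' ?_) hc
  filter_upwards [self_mem_nhdsWithin] with y hy
  exact eq_of_continuousOn_of_int isPreconnected_Ioo (hg.mono Set.Ioo_subset_Ioc_self) hint hx hy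

variable (hev : Even k) (hreal : ∀ n : ℕ, (qCoeff f n).im = 0)
  (hpos : 0 < (qCoeff f (leadIndex f)).re)

include hk hev hreal in
theorem lFun_conj {s : ℂ} : LFun hk f (conj s) = conj (LFun hk f s) := by
  rw [lFun_eq, lFun_eq, lam_conj hk f hev hreal, map_mul, map_div₀, map_ofNat]
  congr 2
  rw [Gammaℂ_def, Gammaℂ_def, map_mul, map_mul, map_ofNat, Gamma_conj]
  congr 2
  have h2pi : (2 * Real.pi : ℂ) = ((2 * Real.pi : ℝ) : ℂ) := by push_cast; rfl
  have h := cpow_conj ((2 * Real.pi : ℝ) : ℂ) (-s) (by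
    rw [arg_ofReal_of_nonneg (by positivity)]; exact Real.pi_pos.ne)
  rw [h2pi, ← map_neg, h, conj_ofReal]

theorem critPt_neg (k : ℤ) (t : ℝ) : critPt k (-t) = conj (critPt k t) := by
  simp [critPt, map_ofNat]

include hev hreal in
theorem lFun_critPt_neg_eq_zero {t : ℝ} :
    LFun hk f (critPt k (-t)) = 0 ↔ LFun hk f (critPt k t) = 0 := by
  rw [critPt_neg, lFun_conj hk f hev hreal]
  simp

include hev hreal in
theorem isSimpleZero_neg {t : ℝ} : IsSimpleZero hk f (-t) ↔ IsSimpleZero hk f t := by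
  have hd : deriv (LFun hk f) (critPt k (-t)) = conj (deriv (LFun hk f) (critPt k t)) := by
    have h1 := (differentiableAt_lFun_critPt hk f t).hasDerivAt.conj_conj
    have h2 : conj ∘ LFun hk f ∘ conj = LFun hk f := by
      ext s
      simp [lFun_conj hk f hev hreal]
    rw [h2, ← critPt_neg] at h1
    exact h1.deriv
  rw [IsSimpleZero, IsSimpleZero, lFun_critPt_neg_eq_zero hk f hev hreal, hd]
  simp

-- L is real on the real ray, so the continuous argument is a constant multiple of π; its limit -0 ·
-- log m at infinity makes it 0.
include hev hreal in
theorem HasArgLimit.eq_zero {ℓ : ℝ} (h : HasArgLimit hk f 0 ℓ) : ℓ = 0 := by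
  obtain ⟨φ, hc, hφ, htop, hlim⟩ := h
  have hint : ∀ σ ∈ Set.Ioi ((k : ℝ) / 2), ∃ n : ℤ, φ σ / Real.pi = n + 0 := by
    intro σ hσ
    obtain ⟨h0, h1⟩ := hφ σ hσ
    obtain ⟨n, hn⟩ := exists_eq_int_mul_pi (norm_pos_iff.2 h0) h1 (by
      rw [← lFun_conj hk f hev hreal]; simp)
    exact ⟨n, by rw [hn, mul_div_cancel_right₀ _ Real.pi_ne_zero, add_zero]⟩
  have hconst : ∀ σ ∈ Set.Ioi ((k : ℝ) / 2), ∀ σ' ∈ Set.Ioi ((k : ℝ) / 2), φ σ = φ σ' :=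
    fun σ hσ σ' hσ' => (div_left_inj' Real.pi_ne_zero).1
      (eq_of_continuousOn_of_int isPreconnected_Ioi (hc.div_const _) hint hσ hσ')
  have hzero : ∀ σ ∈ Set.Ioi ((k : ℝ) / 2), φ σ = 0 := by
    intro σ hσ
    refine tendsto_nhds_unique (tendsto_const_nhds.congr' ?_) (by simpa using htop)
    filter_upwards [eventually_gt_atTop ((k : ℝ) / 2)] with σ' hσ'
    exact hconst σ hσ σ' hσ'
  refine tendsto_nhds_unique hlim (tendsto_const_nhds.congr' ?_)
  filter_upwards [self_mem_nhdsWithin] with σ hσ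
  exact (hzero σ hσ).symm

-- Off the zeros F lies in ℤ + γ. After the local jump is removed F becomes continuous up to t,
-- hence constant on each side; what remains is the half-jump.
include hev hreal hpos in
theorem isStepFunction_theta_add {S : ℝ → ℝ} (hS : ∀ t : ℝ, HasArgLimit hk f t (S t))
    {ord : ℝ → ℕ} (hord : ∀ t, IsZeroOrder hk f t (ord t)) :
    IsStepFunction (fun t => (theta k t + S t) / Real.pi) ord ((1 - (-1 : ℝ) ^ (k / 2)) / 4) := by
  have hpi := Real.pi_ne_zero
  obtain ⟨A, hAc, hA, hAlim⟩ := exists_arg_lFun hk f hreal hpos hS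
  have hne : ∀ s : ℂ, (k : ℝ) / 2 < s.re → LFun hk f s ≠ 0 := by
    intro s hs
    obtain ⟨φ, -, hφ, -⟩ := hS s.im
    have := (hφ s.re hs).1
    rwa [re_add_im] at this
  have hplat : ∀ t, LFun hk f (critPt k t) ≠ 0 →
      ∃ n : ℤ, (theta k t + S t) / Real.pi = n + (1 - (-1 : ℝ) ^ (k / 2)) / 4 := by
    intro t ht
    obtain ⟨n, hn⟩ := phase_of_ne_zero hk f hev hreal (norm_pos_iff.2 ht) ((hS t).lFun_eq hk f)
    exact ⟨n, by rw [hn, mul_div_cancel_right₀ _ hpi]⟩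
  have hθ := continuous_theta hk
  refine ⟨?_, fun t => ?_, fun t => ?_, fun t ht => hplat t ((hord t).eq_zero_iff.1 ht), ?_⟩
  · rcases (k / 2).even_or_odd with h | h
    · left; rw [h.neg_one_zpow]; norm_num
    · right; rw [h.neg_one_zpow]; norm_num
  · obtain ⟨r, hr, g, hg, hgt, hR, -⟩ := exists_local_jump hk f hne hAc hA hAlim (hord t)
    refine ⟨r, hr, fun u h1 h2 => ⟨?_, (hord u).eq_zero_iff.2 (hR u h1 h2).1⟩⟩
    -- To the right g is S minus ord t · π/2, hence the coset shifted by -ord t / 2.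
    have hc := eq_of_continuousOn_Ico (g := fun u => (theta k u + g u) / Real.pi) (a := t)
      (b := t + r) (α := (1 - (-1 : ℝ) ^ (k / 2)) / 4 - ord t / 2)
      ((hθ.continuousOn.add (hg.mono fun x hx => ⟨by linarith [hx.1], hx.2⟩)).div_const _)
      (fun x hx => by
        obtain ⟨n, hn⟩ := hplat x (hR x hx.1 hx.2).1
        refine ⟨n, ?_⟩
        rw [(hR x hx.1 hx.2).2] at hn
        field_simp at hn ⊢
        linarith) ⟨h1, h2⟩
    rw [(hR u h1 h2).2, hgt, ← hc]
    field_simp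
    ring
  · obtain ⟨r, hr, g, hg, hgt, -, hL⟩ := exists_local_jump hk f hne hAc hA hAlim (hord t)
    refine ⟨r, hr, fun u h1 h2 => ⟨?_, (hord u).eq_zero_iff.2 (hL u h1 h2).1⟩⟩
    have hc := eq_of_continuousOn_Ioc (g := fun u => (theta k u + g u) / Real.pi) (a := t - r)
      (b := t) (α := (1 - (-1 : ℝ) ^ (k / 2)) / 4 + ord t / 2)
      ((hθ.continuousOn.add (hg.mono fun x hx => ⟨hx.1, by linarith [hx.2]⟩)).div_const _)
      (fun x hx => by
        obtain ⟨n, hn⟩ := hplat x (hL x hx.1 hx.2).1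
        refine ⟨n, ?_⟩
        rw [(hL x hx.1 hx.2).2] at hn
        field_simp at hn ⊢
        linarith) ⟨h1, h2⟩
    rw [(hL u h1 h2).2, hgt, ← hc]
    field_simp
    ring
  · simp [theta_zero, (hS 0).eq_zero hk f hev hreal]

end

/-! ### Growth of Λ and infinitude of the zeros. -/

theorem norm_Gamma_le_Gamma_re {s : ℂ} (hs : 0 < s.re) : ‖Gamma s‖ ≤ Real.Gamma s.re := by
  rw [Gamma_eq_integral hs, GammaIntegral, Real.Gamma_eq_integral hs]
  refine MeasureTheory.norm_integral_le_of_norm_le (Real.GammaIntegral_convergent hs) ?_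
  filter_upwards [MeasureTheory.ae_restrict_mem measurableSet_Ioi] with x hx
  rw [norm_mul, norm_real, Real.norm_of_nonneg (Real.exp_pos _).le,
    norm_cpow_eq_rpow_re_of_pos hx, sub_re, one_re]

theorem norm_gammaℂ_div_two_le {s : ℂ} (hs : 0 < s.re) : ‖Gammaℂ s / 2‖ ≤ Real.Gamma s.re := by
  have h1 : (1 : ℝ) ≤ 2 * Real.pi := by linarith [Real.pi_gt_three]
  have h2 : ‖(2 * Real.pi : ℂ) ^ (-s)‖ ≤ 1 := by
    rw [show (2 * Real.pi : ℂ) = ((2 * Real.pi : ℝ) : ℂ) by push_cast; rfl,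
      norm_cpow_eq_rpow_re_of_pos (by linarith)]
    exact Real.rpow_le_one_of_one_le_of_nonpos h1 (by simp [hs.le])
  rw [Gammaℂ_def, show 2 * (2 * Real.pi : ℂ) ^ (-s) * Gamma s / 2 =
    (2 * Real.pi : ℂ) ^ (-s) * Gamma s by ring, norm_mul]
  exact (mul_le_of_le_one_left (norm_nonneg _) h2).trans (norm_Gamma_le_Gamma_re hs)

section

variable {k : ℤ} (hk : 4 ≤ k) (f : ModularForm 𝒮ℒ k)

theorem isStrongFEPair_fePair (hcusp : qCoeff f 0 = 0) : IsStrongFEPair (fePair hk f) :=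
  ⟨by rw [fePair_f₀, hcusp], by rw [fePair_g₀, fePair_f₀, hcusp]⟩

/-- The completed `L`-function of a cusp form is bounded in vertical strips. -/
theorem exists_norm_lam_le (hcusp : qCoeff f 0 = 0) (a b : ℝ) :
    ∃ B : ℝ, ∀ s : ℂ, a ≤ s.re → s.re ≤ b → ‖Lam hk f s‖ ≤ B := by
  have hst := isStrongFEPair_fePair hk f hcusp
  have ha := (hst.hasMellin a).1.norm
  have hb := (hst.hasMellin b).1.norm
  refine ⟨∫ x in Set.Ioi (0 : ℝ), (‖(x : ℂ) ^ ((a : ℂ) - 1) • (fePair hk f).f x‖ +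
    ‖(x : ℂ) ^ ((b : ℂ) - 1) • (fePair hk f).f x‖), fun s h1 h2 => ?_⟩
  have he : Lam hk f s = mellin (fePair hk f).f s := congrFun hst.Λ_eq s
  rw [he, mellin]
  refine MeasureTheory.norm_integral_le_of_norm_le (ha.add hb) ?_
  filter_upwards [MeasureTheory.ae_restrict_mem measurableSet_Ioi] with x hx
  have hx' : (0 : ℝ) < x := hx
  simp only [norm_smul, norm_cpow_eq_rpow_re_of_pos hx', sub_re, ofReal_re, one_re]
  rw [← add_mul]
  refine mul_le_mul_of_nonneg_right ?_ (norm_nonneg _)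
  have p1 := Real.rpow_pos_of_pos hx' (a - 1)
  have p2 := Real.rpow_pos_of_pos hx' (b - 1)
  rcases le_total 1 x with h | h
  · linarith [Real.rpow_le_rpow_of_exponent_le h (by linarith : s.re - 1 ≤ b - 1)]
  · linarith [Real.rpow_le_rpow_of_exponent_ge hx' h (by linarith : a - 1 ≤ s.re - 1)]

theorem exists_norm_lFun_le : ∃ C : ℝ, ∀ s : ℂ, k + 2 ≤ s.re → ‖LFun hk f s‖ ≤ C := by
  have hk4 : (4 : ℝ) ≤ k := by exact_mod_cast hk
  refine ⟨∑' n : ℕ, ‖qCoeff f n / (n : ℂ) ^ ((k + 2 : ℝ) : ℂ)‖, fun s hs => ?_⟩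
  rw [← (hasSum_lFun hk f (s := s) (by linarith)).tsum_eq]
  refine tsum_of_norm_bounded (hasSum_lFun hk f (s := ((k + 2 : ℝ) : ℂ)) (by simp)).summable.norm.hasSum
    fun n => ?_
  rcases n.eq_zero_or_pos with rfl | hn
  · rw [Nat.cast_zero, zero_cpow, div_zero, norm_zero]
    · positivity
    · rintro rfl
      simp only [zero_re] at hs
      linarith
  · have hn1 : (1 : ℝ) ≤ n := by exact_mod_cast hn
    rw [norm_div, norm_div, norm_natCast_cpow_of_pos hn, norm_natCast_cpow_of_pos hn, ofReal_re]
    gcongr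

variable (hev : Even k)

include hev in
/-- The completed `L`-function of a cusp form has order one. -/
theorem exists_norm_lam_le_factorial (hcusp : qCoeff f 0 = 0) :
    ∃ B : ℝ, 0 < B ∧ ∀ (N : ℕ) (s : ℂ), ‖s‖ ≤ N →
      ‖Lam hk f s‖ ≤ B * (N + k.toNat).factorial := by
  have hk4 : (4 : ℝ) ≤ k := by exact_mod_cast hk
  obtain ⟨B, hB⟩ := exists_norm_lam_le hk f hcusp (k / 2) (k + 2)
  obtain ⟨C, hC⟩ := exists_norm_lFun_le hk f
  have hkn : ((k.toNat : ℕ) : ℝ) = k := by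
    have : ((k.toNat : ℕ) : ℤ) = k := Int.toNat_of_nonneg (by omega)
    exact_mod_cast this
  -- The Mellin bound covers the strip next to the line; beyond it L is bounded and Γ(Re s) ≤ (N +
  -- k)!. The range reaches N + k so that k - s is also covered when ‖s‖ ≤ N.
  have key : ∀ (N : ℕ) (s : ℂ), (k : ℝ) / 2 ≤ s.re → s.re ≤ N + k →
      ‖Lam hk f s‖ ≤ (|B| + |C| + 1) * (N + k.toNat).factorial := by
    intro N s h1 h2
    have hf1 : (1 : ℝ) ≤ (N + k.toNat).factorial := by exact_mod_cast Nat.one_le_iff_ne_zero.2 (Nat.factorial_ne_zero _)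
    rcases le_total s.re (k + 2) with h | h
    · calc ‖Lam hk f s‖ ≤ |B| := (hB s h1 h).trans (le_abs_self _)
        _ ≤ (|B| + |C| + 1) * 1 := by linarith [abs_nonneg C]
        _ ≤ _ := by gcongr
    · have hre : 0 < s.re := by linarith
      rw [lam_eq hk f hre, norm_mul]
      have hG : Real.Gamma s.re ≤ (N + k.toNat).factorial := by
        rw [← Real.Gamma_nat_eq_factorial]
        refine Real.Gamma_strictMonoOn_Ici.monotoneOn ?_ ?_ ?_
        · change 2 ≤ s.re; linarith
        · change (2 : ℝ) ≤ _; push_cast; linarith [Nat.cast_nonneg (α := ℝ) N]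
        · push_cast; linarith
      calc ‖LFun hk f s‖ * ‖Gammaℂ s / 2‖ ≤ |C| * (N + k.toNat).factorial :=
            mul_le_mul ((hC s h).trans (le_abs_self _))
              ((norm_gammaℂ_div_two_le hre).trans hG) (norm_nonneg _) (abs_nonneg _)
        _ ≤ _ := by gcongr; linarith [abs_nonneg B]
  refine ⟨|B| + |C| + 1, by positivity, fun N s hs => ?_⟩
  have hre := (abs_re_le_norm s).trans hs
  rw [abs_le] at hre
  rcases le_total ((k : ℝ) / 2) s.re with h | h
  · exact key N s h (by linarith)
  · have h1 := key N (k - s) (by simp; linarith) (by simp; linarith)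
    rw [lam_sub hk f hev, norm_mul, norm_zpow, norm_neg, norm_one, one_zpow, one_mul] at h1
    exact h1

/-- The numerator is the logarithm of B (N + K)^{N + K} with b = log B, which dominates the
factorial bound for Λ. -/
theorem tendsto_add_mul_log_div_sq (b : ℝ) (K : ℕ) :
    Tendsto (fun N : ℕ => (b + (N + K : ℕ) * Real.log (N + K : ℕ)) / (N : ℝ) ^ 2) atTop (𝓝 0) := by
  have h1 : Tendsto (fun N : ℕ => ((N : ℝ))⁻¹) atTop (𝓝 0) := tendsto_inv_atTop_nhds_zero_nat
  have h2 : Tendsto (fun N : ℕ => Real.log (N + K : ℕ) / (N + K : ℕ)) atTop (𝓝 0) := by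
    have h3 : Tendsto (fun x : ℝ => Real.log x / x) atTop (𝓝 0) :=
      Real.isLittleO_log_id_atTop.tendsto_div_nhds_zero
    exact h3.comp (tendsto_natCast_atTop_atTop.comp (tendsto_add_atTop_nat K))
  have h4 := ((h1.pow 2).const_mul b).add
    ((((h1.const_mul (K : ℝ)).const_add 1).pow 2).mul h2)
  simp only [mul_zero, add_zero, ne_eq, OfNat.ofNat_ne_zero, not_false_eq_true, zero_pow] at h4
  refine h4.congr' ?_
  filter_upwards [eventually_gt_atTop 0] with N hN
  have hN' : (N : ℝ) ≠ 0 := by exact_mod_cast hN.ne'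
  have hNK : (N : ℝ) + K ≠ 0 := by positivity
  push_cast
  field_simp

variable (hreal : ∀ n : ℕ, (qCoeff f n).im = 0) (hpos : 0 < (qCoeff f (leadIndex f)).re)

theorem gammaℂ_natCast_div_two (n : ℕ) :
    Gammaℂ ((n + 1 : ℕ) : ℂ) / 2 = n.factorial / (2 * Real.pi : ℂ) ^ (n + 1) := by
  rw [Gammaℂ_def, cpow_neg, cpow_natCast]
  push_cast
  rw [Gamma_nat_eq_factorial]
  ring

-- At s = n + 1 the Gamma factor is n!/(2π)^{n+1}, while L(s) m^s stays near a_f(m) > 0. Exponential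
-- growth would force a/2 ≤ C · K · Kⁿ/n!, whose right side tends to 0.
include hpos in
theorem not_norm_lam_le_exp {t ℓ : ℝ} (h : HasArgLimit hk f t ℓ) :
    ¬ ∃ C D : ℝ, ∀ s, ‖Lam hk f s‖ ≤ C * Real.exp (D * ‖s‖) := by
  rintro ⟨C, D, hCD⟩
  obtain ⟨hm, hz⟩ := leadIndex_spec hk f h
  set m := leadIndex f
  have hm0 : (0 : ℝ) < m := by exact_mod_cast hm
  set a := (qCoeff f m).re
  have ha : a ≤ ‖qCoeff f m‖ := re_le_norm _
  obtain ⟨σ₀, hσ₀⟩ := exists_forall_norm_lFun_sub_lt hk f hm hz (half_pos hpos)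
  set K : ℝ := 2 * Real.pi * m * Real.exp D with hK
  have hpi := Real.pi_pos
  have hK0 : 0 < K := by positivity
  have hlim := (FloorSemiring.tendsto_pow_div_factorial_atTop K).const_mul (C * K)
  rw [mul_zero] at hlim
  obtain ⟨n, h1, h2⟩ := ((hlim.eventually_lt_const (half_pos hpos)).and
    (eventually_ge_atTop ⌈σ₀⌉₊)).exists
  have hn : σ₀ < (((n + 1 : ℕ) : ℂ)).re := by
    rw [natCast_re]
    have : σ₀ ≤ n := (Nat.le_ceil _).trans (by exact_mod_cast h2)
    push_cast; linarith
  have h3 := hσ₀ _ hn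
  have h4 : a / 2 ≤ ‖LFun hk f ((n + 1 : ℕ) : ℂ)‖ * (m : ℝ) ^ (n + 1) := by
    have h5 := norm_sub_norm_le (qCoeff f m) (qCoeff f m - LFun hk f ((n + 1 : ℕ) : ℂ) * (m : ℂ) ^ ((n + 1 : ℕ) : ℂ))
    rw [sub_sub_cancel, norm_sub_rev (qCoeff f m), norm_mul, cpow_natCast, norm_pow,
      norm_natCast] at h5
    rw [cpow_natCast] at h3
    linarith
  have h6 := hCD ((n + 1 : ℕ) : ℂ)
  rw [lam_eq hk f (by rw [natCast_re]; positivity), norm_mul, gammaℂ_natCast_div_two, norm_div,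
    norm_natCast, norm_natCast, norm_pow, norm_mul, norm_real, Real.norm_of_nonneg hpi.le] at h6
  simp only [norm_ofNat] at h6
  have hfac : (0 : ℝ) < n.factorial := by exact_mod_cast n.factorial_pos
  have h7 : Real.exp (D * ((n + 1 : ℕ) : ℝ)) = Real.exp D ^ (n + 1) := by
    rw [← Real.exp_nat_mul, mul_comm]
  rw [h7] at h6
  have hp : (0 : ℝ) < (2 * Real.pi) ^ (n + 1) := by positivity
  have h8 : ‖LFun hk f ((n + 1 : ℕ) : ℂ)‖ * (m : ℝ) ^ (n + 1) ≤ C * K * (K ^ n / n.factorial) := by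
    have h9 := mul_le_mul_of_nonneg_right h6
      (show (0 : ℝ) ≤ (2 * Real.pi) ^ (n + 1) * (m : ℝ) ^ (n + 1) / n.factorial by positivity)
    refine (le_of_eq ?_).trans (h9.trans (le_of_eq ?_))
    · field_simp
    · rw [hK]
      field_simp
      ring
  linarith

-- Λ has no zeros to the right of the line, nor to the left by the functional equation; conjugation
-- pairs t with -t. Finitely many zeros with t > 0 thus mean finitely many in all, and Λ would be of
-- exponential growth.
include hev hreal hpos in
theorem infinite_zeros {S : ℝ → ℝ} (hS : ∀ t : ℝ, HasArgLimit hk f t (S t)) :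
    {t : ℝ | 0 < t ∧ LFun hk f (critPt k t) = 0}.Infinite := by
  intro hfin
  have hcusp := (hS 0).qCoeff_zero hk f
  have hkp := half_pos_real hk
  have hne : ∀ s : ℂ, (k : ℝ) / 2 < s.re → Lam hk f s ≠ 0 := by
    intro s hs
    obtain ⟨φ, -, hφ, -⟩ := hS s.im
    have h1 := (hφ s.re hs).1
    rw [re_add_im] at h1
    have hre : 0 < s.re := hkp.trans hs
    rw [lam_eq hk f hre]
    exact mul_ne_zero h1 (div_ne_zero (gammaℂ_ne_zero hre) two_ne_zero)
  have hfin2 : {t : ℝ | LFun hk f (critPt k t) = 0}.Finite := by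
    refine ((hfin.union (hfin.image Neg.neg)).union (Set.finite_singleton 0)).subset ?_
    intro t ht
    rcases lt_trichotomy t 0 with h | h | h
    · exact .inl (.inr ⟨-t, ⟨by linarith, (lFun_critPt_neg_eq_zero hk f hev hreal).2 ht⟩,
        neg_neg t⟩)
    · exact .inr h
    · exact .inl (.inl ⟨h, ht⟩)
  have hfin3 : {s : ℂ | Lam hk f s = 0}.Finite := by
    refine (hfin2.image (critPt k)).subset fun s hs => ?_
    have hs' : Lam hk f s = 0 := hs
    have hre : s.re = (k : ℝ) / 2 := by
      refine le_antisymm (not_lt.1 fun h => hne s h hs) (not_lt.1 fun h => ?_)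
      refine hne (k - s) (by simp; linarith) ?_
      rw [lam_sub hk f hev, hs', mul_zero]
    have e : critPt k s.im = s := by rw [critPt_eq, ← hre, re_add_im]
    refine ⟨s.im, ?_, e⟩
    change LFun hk f (critPt k s.im) = 0
    rw [e, lFun_eq, hs', zero_mul]
  have hd : Differentiable ℂ (Lam hk f) := (isStrongFEPair_fePair hk f hcusp).differentiable_Λ
  obtain ⟨B, hB, hle⟩ := exists_norm_lam_le_factorial hk f hev hcusp
  refine not_norm_lam_le_exp hk f hpos (hS 0) (norm_le_exp_of_finite_zeros hd hfin3
    (tendsto_add_mul_log_div_sq (Real.log B) k.toNat) ?_)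
  filter_upwards [eventually_gt_atTop 0] with N hN s hs
  refine (hle N s hs).trans ?_
  rw [Real.exp_add, Real.exp_log hB, ← Real.log_pow, Real.exp_log (by positivity)]
  gcongr
  exact_mod_cast Nat.factorial_le_pow _

end

/-! ### From the step function to the zeros. -/

section

variable {k : ℤ} (hk : 4 ≤ k) (f : ModularForm 𝒮ℒ k) (hev : Even k)
  (hreal : ∀ n : ℕ, (qCoeff f n).im = 0) (hpos : 0 < (qCoeff f (leadIndex f)).re)

theorem theta_add_eq_iff {k : ℤ} {x y v : ℝ} :
    x + y = (v - (1 + (-1 : ℝ) ^ (k / 2)) / 4) * Real.pi ↔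
      (x + y) / Real.pi = v - (1 / 2 - (1 - (-1 : ℝ) ^ (k / 2)) / 4) := by
  rw [div_eq_iff Real.pi_ne_zero]
  constructor <;> intro h <;> rw [h] <;> ring

include hev hreal hpos in
/-- The zeros on the critical line when `arg L_f` has a limit at every ordinate. -/
theorem zeros_of_forall_argLimit (S : ℝ → ℝ) (hS : ∀ t : ℝ, HasArgLimit hk f t (S t)) :
    {t : ℝ | 0 < t ∧ LFun hk f (critPt k t) = 0}.Infinite ∧
    ((∀ n : ℕ, 1 ≤ n → ∃! t : ℝ,
        theta k t + S t = ((n : ℝ) - (1 + (-1 : ℝ) ^ (k / 2)) / 4) * Real.pi) ↔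
      ∀ t : ℝ, LFun hk f (critPt k t) = 0 → IsSimpleZero hk f t) ∧
    ((∀ t : ℝ, LFun hk f (critPt k t) = 0 → IsSimpleZero hk f t) →
      (∃ z : ℕ → ℝ, StrictMonoOn z (Set.Ici 1) ∧
        z '' Set.Ici 1 = {t : ℝ | 0 < t ∧ LFun hk f (critPt k t) = 0} ∧
        ∀ n : ℕ, 1 ≤ n → ∀ t : ℝ,
          theta k t + S t = ((n : ℝ) - (1 + (-1 : ℝ) ^ (k / 2)) / 4) * Real.pi ↔
            t = z n) ∧
      (∀ T : ℝ, 0 < T → LFun hk f (critPt k T) ≠ 0 →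
        {t : ℝ | 0 < t ∧ t < T ∧ ∃ n : ℕ, 1 ≤ n ∧
          theta k t + S t =
            ((n : ℝ) - (1 + (-1 : ℝ) ^ (k / 2)) / 4) * Real.pi}.Finite ∧
        ({t : ℝ | 0 < t ∧ t < T ∧ ∃ n : ℕ, 1 ≤ n ∧
          theta k t + S t =
            ((n : ℝ) - (1 + (-1 : ℝ) ^ (k / 2)) / 4) * Real.pi}.ncard : ℝ) =
          1 / Real.pi * theta k T + 1 / Real.pi * S T - (1 - (-1 : ℝ) ^ (k / 2)) / 4)) := by
  choose ord hord using fun t => exists_isZeroOrder hk f (hS t)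
  have hstep := isStepFunction_theta_add hk f hev hreal hpos hS hord
  have hzero : ∀ t, ord t ≠ 0 ↔ LFun hk f (critPt k t) = 0 := fun t => by
    rw [Ne, (hord t).eq_zero_iff, not_not]
  have hset : {t : ℝ | 0 < t ∧ LFun hk f (critPt k t) = 0} = {t | 0 < t ∧ ord t ≠ 0} := by
    simp_rw [hzero]
  have hinf := infinite_zeros hk f hev hreal hpos hS
  have hsimple : (∀ t, LFun hk f (critPt k t) = 0 → IsSimpleZero hk f t) ↔ ∀ t, ord t ≤ 1 := by
    refine forall_congr' fun t => ?_
    rw [← hzero, ← (hord t).eq_one_iff]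
    omega
  simp_rw [theta_add_eq_iff]
  rw [hset] at hinf ⊢
  rw [hsimple]
  refine ⟨hinf, ⟨fun huniq t => ?_, fun ho n hn => ?_⟩, fun ho => ⟨?_, fun T hT hLT => ?_⟩⟩
  · rcases le_total 0 t with ht | ht
    · exact hstep.ord_le_one huniq ht
    -- The equations with n ≥ 1 control only t ≥ 0; negative ordinates follow by conjugation, which
    -- preserves being a zero and being simple.
    · have h1 := hstep.ord_le_one huniq (t := -t) (by linarith)
      have h2 : ord (-t) = 0 ↔ ord t = 0 := by
        rw [(hord (-t)).eq_zero_iff, (hord t).eq_zero_iff, Ne, Ne,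
          lFun_critPt_neg_eq_zero hk f hev hreal]
      have h3 : ord (-t) = 1 ↔ ord t = 1 := by
        rw [(hord (-t)).eq_one_iff, (hord t).eq_one_iff, isSimpleZero_neg hk f hev hreal]
      omega
  · obtain ⟨t, ht⟩ := hstep.exists_eq hinf ho hn
    exact ⟨t, ht, fun u hu => hstep.eq_of_eq (n := n) (by exact_mod_cast hu)
      (by exact_mod_cast ht)⟩
  · exact hstep.exists_enumeration hinf ho
  · obtain ⟨h1, h2⟩ := hstep.count hinf ho hT ((hord T).eq_zero_iff.2 hLT)
    refine ⟨h1, h2.trans ?_⟩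
    ring

end

/-! ### The discriminant form. -/

section Delta

theorem exists_map_ofReal_eq {p : PowerSeries ℂ} (hp : ∀ n, (p.coeff n).im = 0) :
    ∃ q : PowerSeries ℝ, PowerSeries.map ofRealHom q = p := by
  refine ⟨PowerSeries.mk fun n => (p.coeff n).re, ?_⟩
  ext n
  simp only [PowerSeries.coeff_map, PowerSeries.coeff_mk, ofRealHom_eq_coe]
  apply Complex.ext <;> simp [hp n]

theorem qExpansion_E_im {k : ℕ} (hk : 3 ≤ k) (hk2 : Even k) (n : ℕ) :
    ((UpperHalfPlane.qExpansion 1 (ModularForm.E hk)).coeff n).im = 0 := by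
  rw [EisensteinSeries.E_qExpansion_coeff hk hk2]
  split_ifs
  · simp
  · rw [← conj_eq_iff_im]
    simp only [map_mul, map_neg, map_div₀, map_natCast, map_ratCast, map_ofNat]

theorem coe_Delta : (Delta : UpperHalfPlane → ℂ) = ModularForm.discriminant := rfl

theorem qCoeff_Delta_one : qCoeff Delta 1 = 1 := by
  rw [qCoeff, coe_Delta]
  exact ModularForm.discriminant_qExpansion_coeff_one

/-- 1728Δ = E₄³ - E₆², and the Eisenstein series have real coefficients. -/
theorem qCoeff_Delta_im (n : ℕ) : (qCoeff Delta n).im = 0 := by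
  obtain ⟨p, hp⟩ := exists_map_ofReal_eq (qExpansion_E_im (by norm_num : 3 ≤ 4) ⟨2, rfl⟩)
  obtain ⟨q, hq⟩ := exists_map_ofReal_eq (qExpansion_E_im (by norm_num : 3 ≤ 6) ⟨3, rfl⟩)
  have h1 : ((1728 : ℂ) • (Delta : UpperHalfPlane → ℂ)) =
      (ModularForm.E₄.pow 3 : UpperHalfPlane → ℂ) - (ModularForm.E₆.pow 2 : UpperHalfPlane → ℂ) := by
    ext z
    simp only [coe_Delta, Pi.smul_apply, smul_eq_mul, Pi.sub_apply, ModularForm.coe_pow,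
      Pi.pow_apply, ModularForm.discriminant_eq_E₄_cube_sub_E₆_sq]
    ring
  have h2 := congrArg (UpperHalfPlane.qExpansion 1) h1
  rw [ModularForm.qExpansion_smul one_pos one_mem_strictPeriods_SL,
    ModularForm.qExpansion_sub one_pos one_mem_strictPeriods_SL,
    ModularForm.qExpansion_pow one_pos one_mem_strictPeriods_SL,
    ModularForm.qExpansion_pow one_pos one_mem_strictPeriods_SL, ← hp, ← hq, ← map_pow,
    ← map_pow, ← map_sub] at h2
  have h3 := congrArg (fun r => PowerSeries.coeff n r) h2
  simp only [PowerSeries.coeff_smul, PowerSeries.coeff_map, smul_eq_mul, ofRealHom_eq_coe] at h3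
  have h4 := congrArg im h3
  simp only [mul_im, ofReal_im] at h4
  have h5 : (1728 : ℂ).im = 0 := rfl
  have h6 : (1728 : ℂ).re = 1728 := rfl
  rw [h5, h6, zero_mul, add_zero] at h4
  exact (mul_eq_zero.1 h4).resolve_left (by norm_num)

theorem leadIndex_Delta : leadIndex Delta = 1 := by
  have h : (1 : ℕ) ∈ {n : ℕ | 1 ≤ n ∧ qCoeff Delta n ≠ 0} :=
    ⟨le_rfl, by rw [qCoeff_Delta_one]; exact one_ne_zero⟩
  exact le_antisymm (Nat.sInf_le h) (Nat.sInf_mem ⟨1, h⟩).1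

theorem qCoeff_leadIndex_Delta_re_pos : 0 < (qCoeff Delta (leadIndex Delta)).re := by
  rw [leadIndex_Delta, qCoeff_Delta_one, one_re]
  exact one_pos

end Delta

end ModularZeros

theorem mainTheorem4 :
    (∀ (k : ℤ) (hk : 4 ≤ k) (_ : Even k) (f : ModularForm 𝒮ℒ k)
      (_ : ∀ n : ℕ, (qCoeff f n).im = 0)
      (_ : 0 < (qCoeff f (leadIndex f)).re),
      -- each ordinate separately
      (∀ t ℓ : ℝ, HasArgLimit hk f t ℓ →
        (IsSimpleZero hk f t →
          ∃ n : ℤ, theta k t + ℓ = ((n : ℝ) - (1 + (-1 : ℝ) ^ (k / 2)) / 4) * Real.pi) ∧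
        ((∃ n : ℤ, theta k t + ℓ = ((n : ℝ) - (1 + (-1 : ℝ) ^ (k / 2)) / 4) * Real.pi) →
          LFun hk f (critPt k t) = 0)) ∧
      -- the limit exists for every ordinate
      (∀ S : ℝ → ℝ, (∀ t : ℝ, HasArgLimit hk f t (S t)) →
        {t : ℝ | 0 < t ∧ LFun hk f (critPt k t) = 0}.Infinite ∧
        ((∀ n : ℕ, 1 ≤ n → ∃! t : ℝ,
            theta k t + S t = ((n : ℝ) - (1 + (-1 : ℝ) ^ (k / 2)) / 4) * Real.pi) ↔
          ∀ t : ℝ, LFun hk f (critPt k t) = 0 → IsSimpleZero hk f t) ∧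
        ((∀ t : ℝ, LFun hk f (critPt k t) = 0 → IsSimpleZero hk f t) →
          (∃ z : ℕ → ℝ, StrictMonoOn z (Set.Ici 1) ∧
            z '' Set.Ici 1 = {t : ℝ | 0 < t ∧ LFun hk f (critPt k t) = 0} ∧
            ∀ n : ℕ, 1 ≤ n → ∀ t : ℝ,
              theta k t + S t = ((n : ℝ) - (1 + (-1 : ℝ) ^ (k / 2)) / 4) * Real.pi ↔
                t = z n) ∧
          (∀ T : ℝ, 0 < T → LFun hk f (critPt k T) ≠ 0 →
            {t : ℝ | 0 < t ∧ t < T ∧ ∃ n : ℕ, 1 ≤ n ∧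
              theta k t + S t =
                ((n : ℝ) - (1 + (-1 : ℝ) ^ (k / 2)) / 4) * Real.pi}.Finite ∧
            ({t : ℝ | 0 < t ∧ t < T ∧ ∃ n : ℕ, 1 ≤ n ∧
              theta k t + S t =
                ((n : ℝ) - (1 + (-1 : ℝ) ^ (k / 2)) / 4) * Real.pi}.ncard : ℝ) =
              1 / Real.pi * theta k T + 1 / Real.pi * S T - (1 - (-1 : ℝ) ^ (k / 2)) / 4)))) ∧
    -- the case of the discriminant form, `k = 12`
    (∀ hk : (4 : ℤ) ≤ 12,
      (∀ t ℓ : ℝ, HasArgLimit hk Delta t ℓ →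
        (IsSimpleZero hk Delta t →
          ∃ n : ℤ, theta 12 t + ℓ = ((n : ℝ) - 1 / 2) * Real.pi) ∧
        ((∃ n : ℤ, theta 12 t + ℓ = ((n : ℝ) - 1 / 2) * Real.pi) →
          LFun hk Delta (critPt 12 t) = 0)) ∧
      (∀ S : ℝ → ℝ, (∀ t : ℝ, HasArgLimit hk Delta t (S t)) →
        {t : ℝ | 0 < t ∧ LFun hk Delta (critPt 12 t) = 0}.Infinite ∧
        ((∀ n : ℕ, 1 ≤ n → ∃! t : ℝ,
            theta 12 t + S t = ((n : ℝ) - 1 / 2) * Real.pi) ↔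
          ∀ t : ℝ, LFun hk Delta (critPt 12 t) = 0 → IsSimpleZero hk Delta t) ∧
        ((∀ t : ℝ, LFun hk Delta (critPt 12 t) = 0 → IsSimpleZero hk Delta t) →
          (∃ z : ℕ → ℝ, StrictMonoOn z (Set.Ici 1) ∧
            z '' Set.Ici 1 = {t : ℝ | 0 < t ∧ LFun hk Delta (critPt 12 t) = 0} ∧
            ∀ n : ℕ, 1 ≤ n → ∀ t : ℝ,
              theta 12 t + S t = ((n : ℝ) - 1 / 2) * Real.pi ↔ t = z n) ∧
          (∀ T : ℝ, 0 < T → LFun hk Delta (critPt 12 T) ≠ 0 →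
            {t : ℝ | 0 < t ∧ t < T ∧ ∃ n : ℕ, 1 ≤ n ∧
              theta 12 t + S t = ((n : ℝ) - 1 / 2) * Real.pi}.Finite ∧
            ({t : ℝ | 0 < t ∧ t < T ∧ ∃ n : ℕ, 1 ≤ n ∧
              theta 12 t + S t = ((n : ℝ) - 1 / 2) * Real.pi}.ncard : ℝ) =
              1 / Real.pi * theta 12 T + 1 / Real.pi * S T)))) := by

  refine ⟨fun k hk hev f hreal hpos => ⟨fun t ℓ h => zeros_of_argLimit hk f hev hreal h,
    fun S hS => zeros_of_forall_argLimit hk f hev hreal hpos S hS⟩, fun hk => ?_⟩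
  have hev : Even (12 : ℤ) := ⟨6, rfl⟩
  have h1 := fun t ℓ => zeros_of_argLimit (t := t) (ℓ := ℓ) hk Delta hev qCoeff_Delta_im
  have h2 := zeros_of_forall_argLimit hk Delta hev qCoeff_Delta_im qCoeff_leadIndex_Delta_re_pos
  -- Here ε = (-1)^6 = 1, so the shift in (E_n) is 1/2 and the constant γ in the count vanishes.
  have e : (-1 : ℝ) ^ ((12 : ℤ) / 2) = 1 := by norm_num
  have e' : ((1 : ℝ) + 1) / 4 = 1 / 2 := by norm_num
  rw [e] at h1 h2
  rw [e'] at h1 h2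
  simp only [sub_self, zero_div, sub_zero] at h2
  exact ⟨h1, h2⟩
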